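/- **Setting.** Let $\hat M=\{\hat T_i\}_{i=1}^{\ell}$ be a reference macro-element: a finite family of compact convex sets $\hat T_i\subset\mathbb R^2$ (triangles, rectangles, ...) with non-empty, pairwise disjoint interiors, such that $\Lambda:=\bigcup_i \hat T_i$ has connected interior. For a finite set $\boldsymbol R\subset\mathbb N_0^2$ of multi-indices and $\boldsymbol\gamma\in\mathbb N_0^2$ put $\boldsymbol R+\boldsymbol\gamma=\{\boldsymbol\alpha+\boldsymbol\gamma:\boldsymbol\alpha\in\boldsymbol R\}$, let $\overline{\boldsymbol R}:=\boldsymbol R\cup\{\boldsymbol\alpha+\boldsymbol e_i:\boldsymbol\alpha\in\boldsymbol R,\ i=1,2\}$ be its hull, and let $\boldsymbol R(\Lambda)$ be the span of the monomials $\boldsymbol X^{\boldsymbol\alpha}$, $\boldsymbol\alpha\in\boldsymbol R$, on $\Lambda$. For $1\le p\le\infty$ and $v\in L^1(\Lambda)$ let, with weak derivatives on the interior of $\Lambda$, $$\|v\|_{\boldsymbol R,p}:=\Big(\sum_{\boldsymbol\alpha\in\boldsymbol R}\|\boldsymbol D^{\boldsymbol\alpha}v\|_{L_p(\Lambda)}^p\Big)^{1/p},\qquad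 |v|_{\overline{\boldsymbol R},p}:=\Big(\sum_{\boldsymbol\alpha\in\overline{\boldsymbol R}\setminus\boldsymbol R}\|\boldsymbol D^{\boldsymbol\alpha}v\|_{L_p(\Lambda)}^p\Big)^{1/p}$$ (the maximum of the $L_\infty$-norms if $p=\infty$; the value is $\infty$ if one of the derivatives does not exist in $L_p$), and $H^{\boldsymbol R}_p(\Lambda):=\{v\in L^1(\Lambda):\|v\|_{\boldsymbol R,p}<\infty\}$. Since $\overline{\boldsymbol R}+\boldsymbol\gamma=\overline{\boldsymbol R+\boldsymbol\gamma}$, the semi-norm $|v|_{\overline{\boldsymbol R}+\boldsymbol\gamma,p}$ is the one over $(\overline{\boldsymbol R}\setminus\boldsymbol R)+\boldsymbol\gamma$. **Lemma.** Let $1\le p\le\infty$, let $\boldsymbol\gamma$ be a multi-index, and let $\boldsymbol P,\boldsymbol Q$ be finite sets of multi-indices with $\boldsymbol 0\in\boldsymbol P$, $\boldsymbol 0\in\boldsymbol Q$ and $\boldsymbol P\subset\overline{\boldsymbol Q}$. Let $S(\hat M)\subset H^{\boldsymbol P+\boldsymbol\gamma}_p(\Lambda)$ be a linear space of functions whose restriction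 to each $\hat T_i$ is a polynomial, let $\mu\in\mathbb N_0$, and let $I:C^\mu(\Lambda)\to S(\hat M)$ be a linear operator. Assume that there are linear functionals $F_i$, $i=1,\dots,j=\dim\boldsymbol D^{\boldsymbol\gamma}S(\hat M)$, on $H^{\overline{\boldsymbol Q}}_p(\Lambda)+\boldsymbol D^{\boldsymbol\gamma}S(\hat M)$, whose restrictions to $H^{\overline{\boldsymbol Q}}_p(\Lambda)$ are bounded with respect to $\|\cdot\|_{\overline{\boldsymbol Q},p}$, such that $$F_i(\boldsymbol D^{\boldsymbol\gamma}Iu)=F_i(\boldsymbol D^{\boldsymbol\gamma}u),\quad i=1,\dots,j,\qquad\forall u\in C^\mu(\Lambda)\cap H^{\overline{\boldsymbol Q}+\boldsymbol\gamma}_p(\Lambda),$$ $$\big(F_i(\boldsymbol D^{\boldsymbol\gamma}s)=0\ \text{ for } i=1,\dots,j\big)\ \Rightarrow\ \boldsymbol D^{\boldsymbol\gamma}s=0\qquad\forall s\in S(\hat M).$$ Then for every $u\in C^\mu(\Lambda)\cap H^{\overline{\boldsymbol Q}+\boldsymbol\gamma}_p(\Lambda)$ there is a unique polynomial $q=q_u\in(\boldsymbol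 Q+\boldsymbol\gamma)(\Lambda)$ with $$\int_\Lambda\boldsymbol D^{\boldsymbol\alpha+\boldsymbol\gamma}(u-q)\,\mathrm d\boldsymbol X=0\qquad\forall\boldsymbol\alpha\in\boldsymbol Q,$$ and there is a constant $C$ independent of $u$ such that $$\|u-Iu\|_{\boldsymbol P+\boldsymbol\gamma,p}\le C\big(|u|_{\overline{\boldsymbol Q}+\boldsymbol\gamma,p}+\|q_u-Iq_u\|_{\boldsymbol P+\boldsymbol\gamma,p}\big)\qquad\forall u\in C^\mu(\Lambda)\cap H^{\overline{\boldsymbol Q}+\boldsymbol\gamma}_p(\Lambda).$$ -/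

import Mathlib

open MeasureTheory Set
open scoped ENNReal NNReal ContDiff

noncomputable section

/-- The hull `P ∪ {α + e₁, α + e₂ : α ∈ P}` of a finite set of multi-indices. -/
def hull (P : Finset (ℕ × ℕ)) : Finset (ℕ × ℕ) :=
  P ∪ P.image (fun α => α + (1, 0)) ∪ P.image (fun α => α + (0, 1))

/-- The translate `P + γ`. -/
def shift (γ : ℕ × ℕ) (P : Finset (ℕ × ℕ)) : Finset (ℕ × ℕ) :=
  P.image (fun α => α + γ)

/-- The classical derivative `∂ₓ^α₁ ∂_y^α₂ φ` of a smooth function on the plane. -/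
def classicalDeriv (α : ℕ × ℕ) (φ : ℝ × ℝ → ℝ) : ℝ × ℝ → ℝ :=
  (fun f z => fderiv ℝ f z (1, 0))^[α.1] ((fun f z => fderiv ℝ f z (0, 1))^[α.2] φ)

/-- The derivative of a smooth compactly supported function is continuous and compactly
supported. -/
theorem classicalDeriv_aux (α : ℕ × ℕ) {φ : ℝ × ℝ → ℝ} (h : ContDiff ℝ ∞ φ)
    (hc : HasCompactSupport φ) :
    ContDiff ℝ ∞ (classicalDeriv α φ) ∧ HasCompactSupport (classicalDeriv α φ) := by
  have key : ∀ (e : ℝ × ℝ) (n : ℕ) (f : ℝ × ℝ → ℝ), ContDiff ℝ ∞ f ∧ HasCompactSupport f →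
      ContDiff ℝ ∞ ((fun (f : ℝ × ℝ → ℝ) z => fderiv ℝ f z e)^[n] f) ∧
        HasCompactSupport ((fun (f : ℝ × ℝ → ℝ) z => fderiv ℝ f z e)^[n] f) := by
    intro e n
    induction n with
    | zero => intro f hf; simpa using hf
    | succ n ih =>
      intro f hf
      rw [Function.iterate_succ_apply]
      refine ih _ ⟨?_, hf.2.fderiv_apply ℝ e⟩
      exact (hf.1.fderiv_right (m := ∞) (by simp)).clm_apply contDiff_const
  exact key _ _ _ (key _ _ _ ⟨h, hc⟩)

/-- `L¹(Ω)`, functions modulo equality almost everywhere. -/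
abbrev L1 (Ω : Set (ℝ × ℝ)) : Type := Lp ℝ 1 (volume.restrict Ω)

/-- `g ∈ L¹(Ω)` is the weak derivative `D^α v` of `v ∈ L¹(Ω)`. -/
def HasWeakDeriv (Ω : Set (ℝ × ℝ)) (α : ℕ × ℕ) (v g : L1 Ω) : Prop :=
  ∀ φ : ℝ × ℝ → ℝ, ContDiff ℝ ∞ φ → HasCompactSupport φ → tsupport φ ⊆ Ω →
    ∫ z in Ω, v z * classicalDeriv α φ z = (-1) ^ (α.1 + α.2) * ∫ z in Ω, g z * φ z

theorem integrable_L1_mul {Ω : Set (ℝ × ℝ)} (v : L1 Ω) {ψ : ℝ × ℝ → ℝ} (h : Continuous ψ)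
    (hc : HasCompactSupport ψ) : Integrable (fun z => v z * ψ z) (volume.restrict Ω) := by
  obtain ⟨C, hC⟩ := h.bounded_above_of_compact_support hc
  exact (L1.integrable_coeFn v).mul_bdd (c := C) h.aestronglyMeasurable
    (Filter.Eventually.of_forall hC)

theorem integral_L1_add_mul {Ω : Set (ℝ × ℝ)} (v w : L1 Ω) {ψ : ℝ × ℝ → ℝ} (h : Continuous ψ)
    (hc : HasCompactSupport ψ) :
    ∫ z in Ω, (v + w : L1 Ω) z * ψ z = (∫ z in Ω, v z * ψ z) + ∫ z in Ω, w z * ψ z := by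
  rw [← integral_add (integrable_L1_mul v h hc) (integrable_L1_mul w h hc)]
  refine integral_congr_ae ?_
  filter_upwards [Lp.coeFn_add v w] with z hz
  rw [hz, Pi.add_apply, add_mul]

theorem integral_L1_smul_mul {Ω : Set (ℝ × ℝ)} (c : ℝ) (v : L1 Ω) (ψ : ℝ × ℝ → ℝ) :
    ∫ z in Ω, (c • v : L1 Ω) z * ψ z = c * ∫ z in Ω, v z * ψ z := by
  rw [← integral_const_mul]
  refine integral_congr_ae ?_
  filter_upwards [Lp.coeFn_smul c v] with z hz
  rw [hz, Pi.smul_apply, smul_eq_mul, mul_assoc]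

theorem HasWeakDeriv.add {Ω : Set (ℝ × ℝ)} {α : ℕ × ℕ} {v w g k : L1 Ω}
    (h : HasWeakDeriv Ω α v g) (h' : HasWeakDeriv Ω α w k) :
    HasWeakDeriv Ω α (v + w) (g + k) := by
  intro φ hφ hc hs
  obtain ⟨hd, hdc⟩ := classicalDeriv_aux α hφ hc
  rw [integral_L1_add_mul v w hd.continuous hdc, integral_L1_add_mul g k hφ.continuous hc,
    h φ hφ hc hs, h' φ hφ hc hs, mul_add]

theorem HasWeakDeriv.smul {Ω : Set (ℝ × ℝ)} {α : ℕ × ℕ} {v g : L1 Ω} (c : ℝ)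
    (h : HasWeakDeriv Ω α v g) : HasWeakDeriv Ω α (c • v) (c • g) := by
  intro φ hφ hc hs
  rw [integral_L1_smul_mul, integral_L1_smul_mul, h φ hφ hc hs]
  ring

theorem HasWeakDeriv.zero (Ω : Set (ℝ × ℝ)) (α : ℕ × ℕ) : HasWeakDeriv Ω α 0 0 := by
  intro φ hφ hc hs
  have h (ψ : ℝ × ℝ → ℝ) : ∫ z in Ω, (0 : L1 Ω) z * ψ z = 0 := by
    simpa using integral_L1_smul_mul (0 : ℝ) (0 : L1 Ω) ψ
  rw [h, h, mul_zero]

/-- `‖D^α v‖_{L_p(Ω)}`, with the value `∞` if `v` has no weak derivative `D^α v` in `L¹(Ω)`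
(weak derivatives on an open set are unique, so that the infimum runs over at most one `g`). -/
def derivNorm (Ω : Set (ℝ × ℝ)) (α : ℕ × ℕ) (p : ℝ≥0∞) (v : L1 Ω) : ℝ≥0∞ :=
  ⨅ (g : L1 Ω) (_ : HasWeakDeriv Ω α v g), eLpNorm g p (volume.restrict Ω)

/-- `‖v‖_{P,p} = (∑_{α ∈ P} ‖D^α v‖_{L_p}^p)^{1/p}`, and the maximum for `p = ∞`. -/
def sobNorm (Ω : Set (ℝ × ℝ)) (P : Finset (ℕ × ℕ)) (p : ℝ≥0∞) (v : L1 Ω) : ℝ≥0∞ :=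
  if p = ⊤ then P.sup (fun α => derivNorm Ω α p v)
  else (∑ α ∈ P, derivNorm Ω α p v ^ p.toReal) ^ (1 / p.toReal)

/-- The semi-norm `|v|_{hull P, p}`: as the norm, but over the multi-indices in
`hull P \ P` only. -/
def sobSemi (Ω : Set (ℝ × ℝ)) (P : Finset (ℕ × ℕ)) (p : ℝ≥0∞) (v : L1 Ω) : ℝ≥0∞ :=
  sobNorm Ω (hull P \ P) p v

theorem derivNorm_lt_top {Ω : Set (ℝ × ℝ)} {α : ℕ × ℕ} {p : ℝ≥0∞} {v : L1 Ω} :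
    derivNorm Ω α p v < ⊤ ↔
      ∃ g : L1 Ω, HasWeakDeriv Ω α v g ∧ MemLp g p (volume.restrict Ω) := by
  simp only [derivNorm, iInf_lt_iff]
  constructor
  · rintro ⟨g, hg, h⟩
    exact ⟨g, hg, Lp.aestronglyMeasurable g, h⟩
  · rintro ⟨g, hg, h⟩
    exact ⟨g, hg, h.2⟩

theorem sobNorm_lt_top {Ω : Set (ℝ × ℝ)} {P : Finset (ℕ × ℕ)} {p : ℝ≥0∞} (hp : 1 ≤ p)
    {v : L1 Ω} : sobNorm Ω P p v < ⊤ ↔ ∀ α ∈ P, derivNorm Ω α p v < ⊤ := by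
  unfold sobNorm
  split_ifs with h
  · exact Finset.sup_lt_iff (by simp)
  · have h0 : 0 < p.toReal := ENNReal.toReal_pos (zero_lt_one.trans_le hp).ne' h
    rw [ENNReal.rpow_lt_top_iff_of_pos (by positivity), ENNReal.sum_lt_top]
    simp only [ENNReal.rpow_lt_top_iff_of_pos h0]

/-- The space `H^P_p(Ω) = {v ∈ L¹(Ω) : ‖v‖_{P,p} < ∞}`, for `1 ≤ p ≤ ∞`. -/
def sobolev (Ω : Set (ℝ × ℝ)) (P : Finset (ℕ × ℕ)) (p : ℝ≥0∞) [hp : Fact (1 ≤ p)] :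
    Submodule ℝ (L1 Ω) where
  carrier := {v | sobNorm Ω P p v < ⊤}
  zero_mem' := by
    refine (sobNorm_lt_top hp.out).2 fun α _ => derivNorm_lt_top.2 ⟨0, HasWeakDeriv.zero Ω α, ?_⟩
    exact (memLp_congr_ae (Lp.coeFn_zero ℝ 1 (volume.restrict Ω))).2 MemLp.zero
  add_mem' := by
    intro v w hv hw
    refine (sobNorm_lt_top hp.out).2 fun α hα => derivNorm_lt_top.2 ?_
    obtain ⟨g, hg, hgp⟩ := derivNorm_lt_top.1 ((sobNorm_lt_top hp.out).1 hv α hα)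
    obtain ⟨k, hk, hkp⟩ := derivNorm_lt_top.1 ((sobNorm_lt_top hp.out).1 hw α hα)
    exact ⟨g + k, hg.add hk, (memLp_congr_ae (Lp.coeFn_add g k)).2 (hgp.add hkp)⟩
  smul_mem' := by
    intro c v hv
    refine (sobNorm_lt_top hp.out).2 fun α hα => derivNorm_lt_top.2 ?_
    obtain ⟨g, hg, hgp⟩ := derivNorm_lt_top.1 ((sobNorm_lt_top hp.out).1 hv α hα)
    exact ⟨c • g, hg.smul c, (memLp_congr_ae (Lp.coeFn_smul c g)).2 (hgp.const_smul c)⟩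

/-- The space `D^γ S = {D^γ s : s ∈ S}`. -/
def derivSpace {Ω : Set (ℝ × ℝ)} (γ : ℕ × ℕ) (S : Submodule ℝ (L1 Ω)) :
    Submodule ℝ (L1 Ω) where
  carrier := {w | ∃ s ∈ S, HasWeakDeriv Ω γ s w}
  zero_mem' := ⟨0, S.zero_mem, HasWeakDeriv.zero Ω γ⟩
  add_mem' := by
    rintro v w ⟨s, hs, h⟩ ⟨t, ht, h'⟩
    exact ⟨s + t, S.add_mem hs ht, h.add h'⟩
  smul_mem' := by
    rintro c v ⟨s, hs, h⟩
    exact ⟨c • s, S.smul_mem c hs, h.smul c⟩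

/-- A macro-element: a finite family of non-overlapping compact convex elements with non-empty
interior (triangles, rectangles, ...) that triangulates a reference domain, i.e. the interior of
the union is connected. -/
structure MacroElement where
  card : ℕ
  elem : Fin card → Set (ℝ × ℝ)
  isCompact_elem : ∀ i, IsCompact (elem i)
  convex_elem : ∀ i, Convex ℝ (elem i)
  interior_elem : ∀ i, (interior (elem i)).Nonempty
  disjoint_elem : ∀ i k, i ≠ k → Disjoint (interior (elem i)) (interior (elem k))
  isConnected_interior : IsConnected (interior (⋃ i, elem i))

namespace MacroElement

/-- The closed reference domain `Λ`, the union of the elements. -/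
def dom (M : MacroElement) : Set (ℝ × ℝ) := ⋃ i, M.elem i

/-- The open reference domain, which differs from `Λ` by a null set. -/
def Ω (M : MacroElement) : Set (ℝ × ℝ) := interior M.dom

theorem isCompact_dom (M : MacroElement) : IsCompact M.dom :=
  isCompact_iUnion M.isCompact_elem

/-- The space `C^μ(Λ)` of functions on the closed set `Λ` that are `μ` times continuously
differentiable up to the boundary. -/
def CSpace (M : MacroElement) (μ : ℕ) : Submodule ℝ (M.dom → ℝ) where
  carrier := {f | ∃ g : ℝ × ℝ → ℝ, ContDiffOn ℝ μ g M.dom ∧ ∀ z : M.dom, f z = g z}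
  zero_mem' := ⟨fun _ => 0, contDiffOn_const, fun _ => rfl⟩
  add_mem' := by
    rintro f f' ⟨g, hg, h⟩ ⟨g', hg', h'⟩
    exact ⟨g + g', hg.add hg', fun z => by simp [h, h']⟩
  smul_mem' := by
    rintro c f ⟨g, hg, h⟩
    exact ⟨c • g, hg.const_smul c, fun z => by simp [h]⟩

open Classical in
/-- Extension by zero of a function on `Λ`. -/
def zeroExt (M : MacroElement) (f : M.dom → ℝ) (z : ℝ × ℝ) : ℝ :=
  if h : z ∈ M.dom then f ⟨z, h⟩ else 0

theorem integrable_zeroExt (M : MacroElement) {μ : ℕ} (u : M.CSpace μ) :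
    Integrable (M.zeroExt u.1) (volume.restrict M.Ω) := by
  obtain ⟨f, g, hg, h⟩ := u
  have h1 : IntegrableOn g M.dom :=
    hg.continuousOn.integrableOn_compact M.isCompact_dom
  have h2 : IntegrableOn (M.zeroExt f) M.dom := by
    refine h1.congr_fun (fun z hz => ?_) M.isCompact_dom.measurableSet
    simp [zeroExt, hz, h]
  exact h2.mono_set interior_subset

/-- The canonical embedding `C^μ(Λ) → L¹(Λ)`. -/
def toL1 (M : MacroElement) (μ : ℕ) : M.CSpace μ →ₗ[ℝ] L1 M.Ω where
  toFun u := (M.integrable_zeroExt u).toL1 _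
  map_add' u v := by
    rw [← Integrable.toL1_add]
    congr 1
    funext z
    by_cases h : z ∈ M.dom <;> simp [zeroExt, h]
  map_smul' c u := by
    rw [RingHom.id_apply, ← Integrable.toL1_smul]
    congr 1
    funext z
    by_cases h : z ∈ M.dom <;> simp [zeroExt, h]

/-- The monomial `x^α₁ y^α₂` as a function on `Λ`. -/
def monomial (M : MacroElement) (μ : ℕ) (α : ℕ × ℕ) : M.CSpace μ :=
  ⟨fun z => z.1.1 ^ α.1 * z.1.2 ^ α.2, fun z => z.1 ^ α.1 * z.2 ^ α.2,
    by fun_prop, fun _ => rfl⟩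

/-- The polynomial space `P(Λ)` spanned by the monomials with exponents in `P`. -/
def polySpace (M : MacroElement) (μ : ℕ) (P : Finset (ℕ × ℕ)) : Submodule ℝ (M.CSpace μ) :=
  Submodule.span ℝ (M.monomial μ '' P)

/-- All elements of `S` are polynomials on every element. -/
def IsPiecewisePolynomial (M : MacroElement) (S : Submodule ℝ (L1 M.Ω)) : Prop :=
  ∀ s ∈ S, ∀ i, ∃ r : MvPolynomial (Fin 2) ℝ,
    ∀ᵐ z ∂(volume.restrict (interior (M.elem i))), s z = MvPolynomial.eval ![z.1, z.2] r

/-- `q` belongs to `(Q + γ)(Λ)` and `∫_Λ D^{α+γ} (u - q) = 0` for all `α ∈ Q`. -/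
def IsMeanPolynomial (M : MacroElement) {μ : ℕ} (Q : Finset (ℕ × ℕ)) (γ : ℕ × ℕ)
    (u q : M.CSpace μ) : Prop :=
  q ∈ M.polySpace μ (shift γ Q) ∧
    ∀ α ∈ Q, ∃ g : L1 M.Ω,
      HasWeakDeriv M.Ω (α + γ) (M.toL1 μ (u - q)) g ∧ ∫ z in M.Ω, g z = 0

end MacroElement

end

/-! Put w = u - q. By linearity u - Iu = (w - Iw) + (q - Iq), so it remains to bound w - Iw by the
semi-norm of u.

Splines. The values F_i(D^γ s) determine D^γ s, and an injective linear map into a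
finite-dimensional space has a left inverse. Hence D^γ s = ∑ F_i(D^γ s) a_i with fixed a_i in D^γ S
(`exists_reconstruction`), and all norms of D^(α+γ) s, α ∈ P, are bounded by ∑ |F_i(D^γ s)|
(`eLpNorm_spline_deriv_le`). Since F_i(D^γ Iw) = F_i(D^γ w), the error w - Iw is bounded by the
derivatives D^(β+γ) w, β ∈ hull Q (`derivNorm_sub_spline_le`).

Bramble–Hilbert. For β ∈ Q the function D^(β+γ) w has mean zero, so Poincaré's inequality bounds it
by its two first derivatives, whose indices lie again in the hull. Repeating this ends in hull Q \ Q
and bounds everything by the semi-norm of w. That is not yet the semi-norm of u: Q need not be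
closed downwards, so D^(α+γ) q may be non-zero for α ∈ hull Q \ Q. Only the coefficients of q at
those β ∈ Q that lie above an index of hull Q \ Q contribute. The system for the coefficients is
triangular, so these depend only on the means of D^(β+γ) u for such β. If β = α + δ with α ∈ hull Q
\ Q, then D^(β+γ) u tested with a bump function equals, up to sign, D^(α+γ) u tested with its δ-th
derivative. Poincaré's inequality normalized by the bump, with the same upward recursion, bounds
these means by the semi-norm of u (`IsJet.eLpNorm_le_of_le`, `eLpNorm_polyDeriv_le`).

Poincaré. No regularity of the boundary is needed. On a convex set the inequality follows by
integrating along segments and mollifying; inequalities on sets with an overlap of positive measure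
combine. Each element interior is convex, finitely many of them fill the domain up to a null set,
and connectedness links them by balls. -/

/-! ### Calculus of weak derivatives -/

/-- Directional derivative of a smooth function, as a smooth function. -/
noncomputable def smoothDirDeriv (e : ℝ × ℝ) (f : {φ : ℝ × ℝ → ℝ // ContDiff ℝ ∞ φ}) :
    {φ : ℝ × ℝ → ℝ // ContDiff ℝ ∞ φ} :=
  ⟨fun z => fderiv ℝ f.1 z e, (f.2.fderiv_right (m := ∞) (by simp)).clm_apply contDiff_const⟩

/-- Symmetry of the second derivative. On the subtype of smooth functions the directional
derivatives are commuting self-maps, so that their iterates can be interchanged. -/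
theorem smoothDirDeriv_commute (e e' : ℝ × ℝ) :
    Function.Commute (smoothDirDeriv e) (smoothDirDeriv e') := by
  rintro ⟨f, hf⟩
  apply Subtype.ext
  funext z
  have hd : DifferentiableAt ℝ (fderiv ℝ f) z :=
    ((hf.fderiv_right (m := ∞) (by simp)).differentiable (by simp)) z
  have hs : IsSymmSndFDerivAt ℝ f z := hf.contDiffAt.isSymmSndFDerivAt 
    (by simpa using WithTop.coe_le_coe.2 (le_top : (2 : ℕ∞) ≤ ⊤))
  have key (a b : ℝ × ℝ) : fderiv ℝ (fun y => fderiv ℝ f y a) z b = fderiv ℝ (fderiv ℝ f) z b a := by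
    rw [fderiv_clm_apply hd (by fun_prop)]
    simp
  simp only [smoothDirDeriv, key]
  exact hs _ _

theorem coe_smoothDirDeriv_iterate (e : ℝ × ℝ) (n : ℕ) (f : {φ : ℝ × ℝ → ℝ // ContDiff ℝ ∞ φ}) :
    ((smoothDirDeriv e)^[n] f).1 = (fun (f : ℝ × ℝ → ℝ) z => fderiv ℝ f z e)^[n] f.1 := by
  induction n generalizing f with
  | zero => rfl
  | succ n ih => rw [Function.iterate_succ_apply, Function.iterate_succ_apply, ih]; rfl

theorem classicalDeriv_eq_coe (α : ℕ × ℕ) {φ : ℝ × ℝ → ℝ} (h : ContDiff ℝ ∞ φ) :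
    classicalDeriv α φ =
      ((smoothDirDeriv (1, 0))^[α.1] ((smoothDirDeriv (0, 1))^[α.2] ⟨φ, h⟩)).1 := by
  rw [coe_smoothDirDeriv_iterate, coe_smoothDirDeriv_iterate]
  rfl

theorem ContDiff.classicalDeriv {φ : ℝ × ℝ → ℝ} (h : ContDiff ℝ ∞ φ) (α : ℕ × ℕ) :
    ContDiff ℝ ∞ (classicalDeriv α φ) := by
  rw [classicalDeriv_eq_coe α h]
  exact Subtype.property _

theorem classicalDeriv_classicalDeriv (α β : ℕ × ℕ) {φ : ℝ × ℝ → ℝ} (h : ContDiff ℝ ∞ φ) :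
    classicalDeriv α (classicalDeriv β φ) = classicalDeriv (α + β) φ := by
  rw [classicalDeriv_eq_coe α (h.classicalDeriv β), classicalDeriv_eq_coe (α + β) h]
  simp only [classicalDeriv_eq_coe β h, Prod.fst_add, Prod.snd_add, Function.iterate_add_apply]
  rw [((smoothDirDeriv_commute (0, 1) (1, 0)).iterate_iterate α.2 β.1).eq]

theorem tsupport_classicalDeriv_subset (α : ℕ × ℕ) (φ : ℝ × ℝ → ℝ) :
    tsupport (classicalDeriv α φ) ⊆ tsupport φ := by
  have key (e : ℝ × ℝ) (n : ℕ) (f : ℝ × ℝ → ℝ) :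
      tsupport ((fun (f : ℝ × ℝ → ℝ) z => fderiv ℝ f z e)^[n] f) ⊆ tsupport f := by
    induction n generalizing f with
    | zero => rfl
    | succ n ih =>
      rw [Function.iterate_succ_apply]
      exact (ih _).trans (tsupport_fderiv_apply_subset ℝ e)
  exact (key _ _ _).trans (key _ _ _)

/-- The fundamental lemma of the calculus of variations, applied to the difference, which is a weak
derivative of 0. -/
theorem HasWeakDeriv.unique {Ω : Set (ℝ × ℝ)} (hΩ : IsOpen Ω) {α : ℕ × ℕ} {v g k : L1 Ω}
    (h : HasWeakDeriv Ω α v g) (h' : HasWeakDeriv Ω α v k) : g = k := by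
  have hd : HasWeakDeriv Ω α (v + (-1 : ℝ) • v) (g + (-1 : ℝ) • k) := h.add (h'.smul _)
  have hloc : LocallyIntegrableOn (g + (-1 : ℝ) • k : L1 Ω) Ω volume :=
    IntegrableOn.locallyIntegrableOn (L1.integrable_coeFn (g + (-1 : ℝ) • k : L1 Ω))
  have h0 := hΩ.ae_eq_zero_of_integral_contDiff_smul_eq_zero hloc fun φ hφ hc hs => by
    have h1 := hd φ hφ hc hs
    obtain ⟨hD, hDc⟩ := classicalDeriv_aux α hφ hc
    rw [integral_L1_add_mul _ _ hD.continuous hDc, integral_L1_smul_mul] at h1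
    have h2 : ∫ z in Ω, (g + (-1 : ℝ) • k : L1 Ω) z * φ z = 0 := by
      have h3 : ((-1 : ℝ) ^ (α.1 + α.2)) ≠ 0 := by simp
      have : (-1 : ℝ) ^ (α.1 + α.2) * ∫ z in Ω, (g + (-1 : ℝ) • k : L1 Ω) z * φ z = 0 := by
        rw [← h1]; ring
      exact (mul_eq_zero.1 this).resolve_left h3
    rw [← h2, setIntegral_eq_integral_of_forall_compl_eq_zero]
    · simp [mul_comm]
    · intro z hz
      rw [image_eq_zero_of_notMem_tsupport fun hz' => hz (hs hz'), mul_zero]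
  have : (g + (-1 : ℝ) • k : L1 Ω) = 0 := by
    rw [Lp.eq_zero_iff_ae_eq_zero]
    exact (ae_restrict_iff' hΩ.measurableSet).2 h0
  simpa [add_neg_eq_zero] using this

/-- Test `h` with the derivative of order α of a test function and cancel the sign. Both derivatives
of u are assumed to exist; neither yields the other. -/
theorem HasWeakDeriv.of_add {Ω : Set (ℝ × ℝ)} {α γ : ℕ × ℕ} {u v g : L1 Ω}
    (h : HasWeakDeriv Ω γ u v) (h' : HasWeakDeriv Ω (α + γ) u g) : HasWeakDeriv Ω α v g := by
  intro φ hφ hc hs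
  obtain ⟨hd, hdc⟩ := classicalDeriv_aux α hφ hc
  have h1 := h _ hd hdc ((tsupport_classicalDeriv_subset α φ).trans hs)
  rw [classicalDeriv_classicalDeriv γ α hφ, add_comm γ α, h' φ hφ hc hs, Prod.fst_add,
    Prod.snd_add, show α.1 + γ.1 + (α.2 + γ.2) = (γ.1 + γ.2) + (α.1 + α.2) by ring, pow_add,
    mul_assoc] at h1
  exact (mul_left_cancel₀ (by simp) h1).symm

theorem HasWeakDeriv.sub {Ω : Set (ℝ × ℝ)} {α : ℕ × ℕ} {v w g k : L1 Ω}
    (h : HasWeakDeriv Ω α v g) (h' : HasWeakDeriv Ω α w k) :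
    HasWeakDeriv Ω α (v - w) (g - k) := by
  simpa [sub_eq_add_neg] using h.add (h'.smul (-1))

theorem HasWeakDeriv.sum {Ω : Set (ℝ × ℝ)} {α : ℕ × ℕ} {ι : Type*} (s : Finset ι)
    {v g : ι → L1 Ω} (h : ∀ i ∈ s, HasWeakDeriv Ω α (v i) (g i)) :
    HasWeakDeriv Ω α (∑ i ∈ s, v i) (∑ i ∈ s, g i) := by
  classical
  induction s using Finset.induction_on with
  | empty => simpa using HasWeakDeriv.zero Ω α
  | insert i s hi ih =>
    rw [Finset.sum_insert hi, Finset.sum_insert hi]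
    exact (h i (by simp)).add (ih fun k hk => h k (by simp [hk]))

/-- Iterated integration by parts in one direction. -/
theorem integral_mul_iterate_fderiv (e : ℝ × ℝ) (n : ℕ) {f φ : ℝ × ℝ → ℝ} (hf : ContDiff ℝ ∞ f)
    (hφ : ContDiff ℝ ∞ φ) (hc : HasCompactSupport φ) :
    ∫ z, f z * (fun (f : ℝ × ℝ → ℝ) z => fderiv ℝ f z e)^[n] φ z =
      (-1) ^ n * ∫ z, (fun (f : ℝ × ℝ → ℝ) z => fderiv ℝ f z e)^[n] f z * φ z := by
  induction n generalizing f φ with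
  | zero => simp
  | succ n ih =>
    have smooth (k : ℝ × ℝ → ℝ) (hk : ContDiff ℝ ∞ k) :
        ContDiff ℝ ∞ (fun z => fderiv ℝ k z e) := (smoothDirDeriv e ⟨k, hk⟩).2
    have hit : ContDiff ℝ ∞ ((fun (f : ℝ × ℝ → ℝ) z => fderiv ℝ f z e)^[n] f) := by
      rw [← coe_smoothDirDeriv_iterate e n ⟨f, hf⟩]
      exact Subtype.property _
    rw [Function.iterate_succ_apply, ih hf (smooth φ hφ) (hc.fderiv_apply ℝ e),
      Function.iterate_succ_apply', integral_mul_fderiv_eq_neg_fderiv_mul_of_integrable]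
    · ring
    · exact ((smooth _ hit).continuous.mul hφ.continuous).integrable_of_hasCompactSupport
        hc.mul_left
    · exact (hit.continuous.mul (smooth _ hφ).continuous).integrable_of_hasCompactSupport
        (hc.fderiv_apply ℝ e).mul_left
    · exact (hit.continuous.mul hφ.continuous).integrable_of_hasCompactSupport hc.mul_left
    · exact fun x _ => hit.differentiable (by simp) x
    · exact fun x _ => hφ.differentiable (by simp) x

theorem integral_mul_classicalDeriv (α : ℕ × ℕ) {f φ : ℝ × ℝ → ℝ} (hf : ContDiff ℝ ∞ f)
    (hφ : ContDiff ℝ ∞ φ) (hc : HasCompactSupport φ) :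
    ∫ z, f z * classicalDeriv α φ z =
      (-1) ^ (α.1 + α.2) * ∫ z, classicalDeriv α f z * φ z := by
  have h2 : ContDiff ℝ ∞ ((fun (f : ℝ × ℝ → ℝ) z => fderiv ℝ f z (0, 1))^[α.2] φ) ∧
      HasCompactSupport ((fun (f : ℝ × ℝ → ℝ) z => fderiv ℝ f z (0, 1))^[α.2] φ) :=
    classicalDeriv_aux (0, α.2) hφ hc
  have h3 : ContDiff ℝ ∞ ((fun (f : ℝ × ℝ → ℝ) z => fderiv ℝ f z (1, 0))^[α.1] f) :=
    hf.classicalDeriv (α.1, 0)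
  -- Integration by parts moves the x-derivatives to f before the y-derivatives, so they arrive in
  -- the opposite order.
  have h4 : classicalDeriv α f = (fun (f : ℝ × ℝ → ℝ) z => fderiv ℝ f z (0, 1))^[α.2]
      ((fun (f : ℝ × ℝ → ℝ) z => fderiv ℝ f z (1, 0))^[α.1] f) := by
    have := classicalDeriv_classicalDeriv (0, α.2) (α.1, 0) hf
    simpa [classicalDeriv] using this.symm
  rw [h4, classicalDeriv, integral_mul_iterate_fderiv (1, 0) α.1 hf h2.1 h2.2,
    integral_mul_iterate_fderiv (0, 1) α.2 h3 hφ hc, pow_add, mul_assoc]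

/-- The test function is supported inside Ω, so both integrals extend to the whole plane and no
boundary term arises. -/
theorem hasWeakDeriv_of_contDiff {Ω : Set (ℝ × ℝ)} {α : ℕ × ℕ} {f : ℝ × ℝ → ℝ}
    (hf : ContDiff ℝ ∞ f) {v g : L1 Ω} (hv : v =ᵐ[volume.restrict Ω] f)
    (hg : g =ᵐ[volume.restrict Ω] classicalDeriv α f) : HasWeakDeriv Ω α v g := by
  intro φ hφ hc hs
  have e1 : ∫ z in Ω, v z * classicalDeriv α φ z = ∫ z, f z * classicalDeriv α φ z := by
    refine Eq.trans ?_ (setIntegral_eq_integral_of_forall_compl_eq_zero (s := Ω) ?_)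
    · exact integral_congr_ae (hv.mono fun z hz => by simp only [hz])
    · intro z hz
      rw [image_eq_zero_of_notMem_tsupport fun hz' =>
        hz (hs (tsupport_classicalDeriv_subset α φ hz')), mul_zero]
  have e2 : ∫ z in Ω, g z * φ z = ∫ z, classicalDeriv α f z * φ z := by
    refine Eq.trans ?_ (setIntegral_eq_integral_of_forall_compl_eq_zero (s := Ω) ?_)
    · exact integral_congr_ae (hg.mono fun z hz => by simp only [hz])
    · intro z hz
      rw [image_eq_zero_of_notMem_tsupport fun hz' => hz (hs hz'), mul_zero]
  rw [e1, e2, integral_mul_classicalDeriv α hf hφ hc]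

theorem derivNorm_eq {Ω : Set (ℝ × ℝ)} (hΩ : IsOpen Ω) {α : ℕ × ℕ} {v g : L1 Ω}
    (h : HasWeakDeriv Ω α v g) (p : ℝ≥0∞) :
    derivNorm Ω α p v = eLpNorm g p (volume.restrict Ω) := by
  refine le_antisymm (iInf₂_le g h) (le_iInf₂ fun k hk => ?_)
  rw [h.unique hΩ hk]

/-- The derivatives of the monomials. -/
theorem classicalDeriv_monomial (α : ℕ × ℕ) (a b : ℕ) :
    classicalDeriv α (fun z => z.1 ^ a * z.2 ^ b) = fun z =>
      ((a.descFactorial α.1 : ℝ) * (b.descFactorial α.2 : ℝ)) *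
        (z.1 ^ (a - α.1) * z.2 ^ (b - α.2)) := by
  have hx (n a b : ℕ) (c : ℝ) : (fun (f : ℝ × ℝ → ℝ) z => fderiv ℝ f z (1, 0))^[n]
      (fun z => c * (z.1 ^ a * z.2 ^ b)) =
      fun z => c * (a.descFactorial n : ℝ) * (z.1 ^ (a - n) * z.2 ^ b) := by
    induction n with
    | zero => simp
    | succ n ih =>
      rw [Function.iterate_succ_apply', ih]
      funext z
      have h1 : HasFDerivAt (fun z : ℝ × ℝ => c * (a.descFactorial n : ℝ) *
          (z.1 ^ (a - n) * z.2 ^ b)) _ z :=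
        (((hasFDerivAt_fst (𝕜 := ℝ) (p := z)).pow (a - n)).mul
          ((hasFDerivAt_snd (𝕜 := ℝ) (p := z)).pow b)).const_mul _
      rw [h1.fderiv, Nat.descFactorial_succ, Nat.sub_sub]
      simp
      ring
  have hy (n a b : ℕ) (c : ℝ) : (fun (f : ℝ × ℝ → ℝ) z => fderiv ℝ f z (0, 1))^[n]
      (fun z => c * (z.1 ^ a * z.2 ^ b)) =
      fun z => c * (b.descFactorial n : ℝ) * (z.1 ^ a * z.2 ^ (b - n)) := by
    induction n with
    | zero => simp
    | succ n ih =>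
      rw [Function.iterate_succ_apply', ih]
      funext z
      have h1 : HasFDerivAt (fun z : ℝ × ℝ => c * (b.descFactorial n : ℝ) *
          (z.1 ^ a * z.2 ^ (b - n))) _ z :=
        (((hasFDerivAt_fst (𝕜 := ℝ) (p := z)).pow a).mul
          ((hasFDerivAt_snd (𝕜 := ℝ) (p := z)).pow (b - n))).const_mul _
      rw [h1.fderiv, Nat.descFactorial_succ, Nat.sub_sub]
      simp
      ring
  have h0 : (fun z : ℝ × ℝ => z.1 ^ a * z.2 ^ b) = fun z => (1 : ℝ) * (z.1 ^ a * z.2 ^ b) := by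
    simp
  rw [h0, classicalDeriv, hy, hx]
  funext z
  ring

/-! ### A Poincaré inequality on convex sets -/

/-- The `L_p` norm of an average is at most the `L_p` norm on the product space. -/
theorem eLpNorm_integral_prod_le {X Y : Type*} [MeasurableSpace X] [MeasurableSpace Y]
    {μ : Measure X} [SFinite μ] {κ : Measure Y} [IsProbabilityMeasure κ] {p : ℝ≥0∞} (hp : 1 ≤ p)
    {H : X × Y → ℝ} (hH : AEStronglyMeasurable H (μ.prod κ)) :
    eLpNorm (fun x => ∫ y, H (x, y) ∂κ) p μ ≤ eLpNorm H p (μ.prod κ) := by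
  have hp0 : p ≠ 0 := (zero_lt_one.trans_le hp).ne'
  by_cases hpt : p = ⊤
  · subst hpt
    rw [eLpNorm_exponent_top, eLpNorm_exponent_top]
    refine eLpNormEssSup_le_of_ae_enorm_bound ?_
    have h : ∀ᵐ z ∂μ.prod κ, ‖H z‖ₑ ≤ eLpNormEssSup H (μ.prod κ) := enorm_ae_le_eLpNormEssSup _ _
    filter_upwards [Measure.ae_ae_of_ae_prod h] with x hx
    refine (enorm_integral_le_lintegral_enorm _).trans ((lintegral_mono_ae hx).trans ?_)
    simp
  · have h0 : 0 < p.toReal := ENNReal.toReal_pos hp0 hpt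
    rw [eLpNorm_eq_lintegral_rpow_enorm_toReal hp0 hpt,
      eLpNorm_eq_lintegral_rpow_enorm_toReal hp0 hpt, lintegral_prod _ (hH.enorm.pow_const _)]
    gcongr ?_ ^ (1 / p.toReal)
    refine lintegral_mono_ae ?_
    filter_upwards [hH.prodMk_left] with x hx
    -- Jensen's inequality, in the form L¹ ≤ L_p for a probability measure.
    have h1 : eLpNorm (fun y => H (x, y)) 1 κ ≤ eLpNorm (fun y => H (x, y)) p κ :=
      eLpNorm_le_eLpNorm_of_exponent_le hp hx
    rw [eLpNorm_one_eq_lintegral_enorm, eLpNorm_eq_lintegral_rpow_enorm_toReal hp0 hpt] at h1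
    calc ‖∫ y, H (x, y) ∂κ‖ₑ ^ p.toReal
        ≤ ((∫⁻ y, ‖H (x, y)‖ₑ ^ p.toReal ∂κ) ^ (1 / p.toReal)) ^ p.toReal := by
          gcongr
          exact (enorm_integral_le_lintegral_enorm _).trans h1
      _ = ∫⁻ y, ‖H (x, y)‖ₑ ^ p.toReal ∂κ := by
          rw [← ENNReal.rpow_mul, one_div_mul_cancel h0.ne', ENNReal.rpow_one]

/-- The Jacobian factor in the plane is s⁻², at most 4 for s ≥ 1/2. -/
theorem volume_preimage_smul_add_le {s : ℝ} (hs : 1 / 2 ≤ s) (a : ℝ × ℝ) (B : Set (ℝ × ℝ)) :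
    volume {x : ℝ × ℝ | s • x + a ∈ B} ≤ 4 * volume B := by
  have hs0 : s ≠ 0 := by linarith
  have h1 : {x : ℝ × ℝ | s • x + a ∈ B} = (fun x => s • x) ⁻¹' ((fun x => x + a) ⁻¹' B) := rfl
  rw [h1, Measure.addHaar_preimage_smul _ hs0, measure_preimage_add_right]
  gcongr
  rw [ENNReal.ofReal_le_iff_le_toReal (by simp)]
  have h2 : Module.finrank ℝ (ℝ × ℝ) = 2 := by simp
  have h3 : (1 / 2 : ℝ) ^ 2 ≤ s ^ 2 := by gcongr
  rw [h2, abs_of_nonneg (by positivity)]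
  calc (s ^ 2)⁻¹ ≤ ((1 / 2 : ℝ) ^ 2)⁻¹ := by gcongr
    _ = _ := by norm_num

/-- A point that is uniformly distributed on a segment between independent points of a convex set
has a bounded density. -/
theorem map_segment_le {V : Set (ℝ × ℝ)} (hV : Convex ℝ V) (hVm : MeasurableSet V) :
    Measure.map (fun w : ((ℝ × ℝ) × (ℝ × ℝ)) × ℝ => w.1.2 + w.2 • (w.1.1 - w.1.2))
      (((volume.restrict V).prod (volume.restrict V)).prod (volume.restrict (Icc (0 : ℝ) 1))) ≤
      (4 * volume V) • volume.restrict V := by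
  have hmeas : Measurable
      (fun w : ((ℝ × ℝ) × (ℝ × ℝ)) × ℝ => w.1.2 + w.2 • (w.1.1 - w.1.2)) := by fun_prop
  refine Measure.le_iff.2 fun A hA => ?_
  rw [Measure.map_apply hmeas hA, Measure.prod_apply_symm (hmeas hA)]
  have key : ∀ t ∈ Icc (0 : ℝ) 1, ((volume.restrict V).prod (volume.restrict V))
      ((fun w => (w, t)) ⁻¹' ((fun w : ((ℝ × ℝ) × (ℝ × ℝ)) × ℝ =>
        w.1.2 + w.2 • (w.1.1 - w.1.2)) ⁻¹' A)) ≤ 4 * volume V * volume.restrict V A := by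
    intro t ht
    have hm := (measurable_prodMk_right (y := t) : Measurable
      fun w : (ℝ × ℝ) × (ℝ × ℝ) => (w, t)) (hmeas hA)
    -- The point is t x + (1 - t) y. Change variables in whichever of x and y has the weight at
    -- least 1/2, with the other one fixed; convexity keeps the point in V.
    rcases le_total (1 / 2) t with h | h
    · rw [Measure.prod_apply_symm hm]
      calc _ ≤ ∫⁻ _ in V, 4 * volume.restrict V A := by
            refine lintegral_mono_ae ((ae_restrict_iff' hVm).2 (.of_forall fun y hy => ?_))
            rw [Measure.restrict_apply' hVm, Measure.restrict_apply hA]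
            refine (measure_mono ?_).trans (volume_preimage_smul_add_le h ((1 - t) • y) (A ∩ V))
            rintro x ⟨hx, hxV⟩
            have e : y + t • (x - y) = t • x + (1 - t) • y := by module
            refine ⟨?_, hV hxV hy ht.1 (by linarith [ht.2]) (by ring)⟩
            rw [← e]
            exact hx
        _ = _ := by simp; ring
    · rw [Measure.prod_apply hm]
      calc _ ≤ ∫⁻ _ in V, 4 * volume.restrict V A := by
            refine lintegral_mono_ae ((ae_restrict_iff' hVm).2 (.of_forall fun x hx => ?_))
            rw [Measure.restrict_apply' hVm, Measure.restrict_apply hA]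
            refine (measure_mono ?_).trans
              (volume_preimage_smul_add_le (s := 1 - t) (by linarith) (t • x) (A ∩ V))
            rintro y ⟨hy, hyV⟩
            have e : y + t • (x - y) = (1 - t) • y + t • x := by module
            refine ⟨?_, hV hyV hx (by linarith) ht.1 (by ring)⟩
            rw [← e]
            exact hy
        _ = _ := by simp; ring
  calc _ ≤ ∫⁻ _ in Icc (0 : ℝ) 1, 4 * volume V * volume.restrict V A :=
        lintegral_mono_ae ((ae_restrict_iff' measurableSet_Icc).2 (.of_forall key))
    _ = _ := by simp

theorem sub_eq_integral_fderiv_segment {F : ℝ × ℝ → ℝ} (hF : ContDiff ℝ 1 F) (x y : ℝ × ℝ) :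
    F x - F y = ∫ t in Icc (0 : ℝ) 1, ((x - y).1 * fderiv ℝ F (y + t • (x - y)) (1, 0) +
      (x - y).2 * fderiv ℝ F (y + t • (x - y)) (0, 1)) := by
  have hd (t : ℝ) : HasDerivAt (fun t : ℝ => F (y + t • (x - y)))
      (fderiv ℝ F (y + t • (x - y)) (x - y)) t := by
    have h1 : HasDerivAt (fun t : ℝ => y + t • (x - y)) (x - y) t := by
      simpa using ((hasDerivAt_id t).smul_const (x - y)).const_add y
    exact ((hF.differentiable (by simp)) _).hasFDerivAt.comp_hasDerivAt t h1
  have hc : Continuous fun t : ℝ => fderiv ℝ F (y + t • (x - y)) (x - y) := by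
    have := hF.continuous_fderiv (by simp)
    fun_prop
  have h := intervalIntegral.integral_eq_sub_of_hasDerivAt (a := 0) (b := 1)
    (fun t _ => hd t) (hc.intervalIntegrable _ _)
  rw [intervalIntegral.integral_of_le zero_le_one, ← integral_Icc_eq_integral_Ioc] at h
  simp only [one_smul, zero_smul, add_zero, add_sub_cancel] at h
  rw [← h]
  congr 1
  funext t
  generalize fderiv ℝ F (y + t • (x - y)) = A
  have e : A (x - y) = A ((x - y).1 • ((1, 0) : ℝ × ℝ) + (x - y).2 • ((0, 1) : ℝ × ℝ)) := by
    congr 1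
    ext <;> simp
  rw [e, map_add, map_smul, map_smul]
  rfl

/-- The factor ℓ(x - y) is at most D, and the rest is a change of variables along `map_segment_le`.
The exponent `(1 / p).toReal` is 0 for p = ∞. -/
theorem eLpNorm_mul_comp_segment_le {V : Set (ℝ × ℝ)} (hV : Convex ℝ V)
    (hVm : MeasurableSet V) {D : ℝ≥0} (hD : ∀ x ∈ V, ∀ y ∈ V, ‖x - y‖ₑ ≤ D) (p : ℝ≥0∞)
    {G : ℝ × ℝ → ℝ} (hG : Continuous G) {ℓ : ℝ × ℝ → ℝ} (hℓ : ∀ x, ‖ℓ x‖ₑ ≤ ‖x‖ₑ) :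
    eLpNorm (fun w : ((ℝ × ℝ) × (ℝ × ℝ)) × ℝ =>
        ℓ (w.1.1 - w.1.2) * G (w.1.2 + w.2 • (w.1.1 - w.1.2))) p
        (((volume.restrict V).prod (volume.restrict V)).prod (volume.restrict (Icc (0 : ℝ) 1))) ≤
      D * ((4 * volume V) ^ (1 / p).toReal * eLpNorm G p (volume.restrict V)) := by
  have hΦm : Measurable
      (fun w : ((ℝ × ℝ) × (ℝ × ℝ)) × ℝ => w.1.2 + w.2 • (w.1.1 - w.1.2)) := by fun_prop
  have hle := map_segment_le hV hVm
  have hae : ∀ᵐ w ∂(((volume.restrict V).prod (volume.restrict V)).prod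
      (volume.restrict (Icc (0 : ℝ) 1))), ‖w.1.1 - w.1.2‖ₑ ≤ D := by
    rw [Measure.prod_restrict, Measure.prod_restrict,
      ae_restrict_iff' ((hVm.prod hVm).prod measurableSet_Icc)]
    exact .of_forall fun w hw => hD _ hw.1.1 _ hw.1.2
  generalize ((volume.restrict V).prod (volume.restrict V)).prod
    (volume.restrict (Icc (0 : ℝ) 1)) = ν at hle hae ⊢
  calc _ ≤ D * eLpNorm
        (G ∘ fun w : ((ℝ × ℝ) × (ℝ × ℝ)) × ℝ => w.1.2 + w.2 • (w.1.1 - w.1.2)) p ν := by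
        have := eLpNorm_le_nnreal_smul_eLpNorm_of_ae_le_mul' (μ := ν)
          (f := fun w => ℓ (w.1.1 - w.1.2) * G (w.1.2 + w.2 • (w.1.1 - w.1.2)))
          (g := G ∘ fun w : ((ℝ × ℝ) × (ℝ × ℝ)) × ℝ => w.1.2 + w.2 • (w.1.1 - w.1.2)) (c := D)
          (hae.mono fun w hw => ?_) p
        · rwa [ENNReal.smul_def, smul_eq_mul] at this
        · rw [enorm_mul]
          exact mul_le_mul' ((hℓ _).trans hw) le_rfl
    _ = D * eLpNorm G p (Measure.map _ ν) := by
        rw [eLpNorm_map_measure hG.aestronglyMeasurable hΦm.aemeasurable]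
    _ ≤ _ := by
        gcongr
        exact eLpNorm_le_of_measure_le_smul hle

/-- The mean oscillation of a smooth function on a convex set is bounded by its gradient. -/
theorem eLpNorm_sub_prod_le_of_contDiff {V : Set (ℝ × ℝ)} (hV : Convex ℝ V)
    (hVm : MeasurableSet V) {D : ℝ≥0} (hD : ∀ x ∈ V, ∀ y ∈ V, ‖x - y‖ₑ ≤ D) {p : ℝ≥0∞}
    (hp : 1 ≤ p) {F : ℝ × ℝ → ℝ} (hF : ContDiff ℝ 1 F) :
    eLpNorm (fun w : (ℝ × ℝ) × (ℝ × ℝ) => F w.1 - F w.2) p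
        ((volume.restrict V).prod (volume.restrict V)) ≤
      D * (4 * volume V) ^ (1 / p).toReal *
        (eLpNorm (fun x => fderiv ℝ F x (1, 0)) p (volume.restrict V) +
          eLpNorm (fun x => fderiv ℝ F x (0, 1)) p (volume.restrict V)) := by
  have hc := hF.continuous_fderiv (by simp)
  have hc1 : Continuous fun x => fderiv ℝ F x (1, 0) := by fun_prop
  have hc2 : Continuous fun x => fderiv ℝ F x (0, 1) := by fun_prop
  have : IsProbabilityMeasure (volume.restrict (Icc (0 : ℝ) 1)) := ⟨by simp⟩
  have b1 := eLpNorm_mul_comp_segment_le hV hVm hD p hc1 (ℓ := Prod.fst)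
    fun x => enorm_le_iff_norm_le.2 (norm_fst_le x)
  have b2 := eLpNorm_mul_comp_segment_le hV hVm hD p hc2 (ℓ := Prod.snd)
    fun x => enorm_le_iff_norm_le.2 (norm_snd_le x)
  have c1 : Continuous fun w : ((ℝ × ℝ) × (ℝ × ℝ)) × ℝ =>
      (w.1.1 - w.1.2).1 * fderiv ℝ F (w.1.2 + w.2 • (w.1.1 - w.1.2)) (1, 0) :=
    Continuous.mul (by fun_prop) (hc1.comp (by fun_prop))
  have c2 : Continuous fun w : ((ℝ × ℝ) × (ℝ × ℝ)) × ℝ =>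
      (w.1.1 - w.1.2).2 * fderiv ℝ F (w.1.2 + w.2 • (w.1.1 - w.1.2)) (0, 1) :=
    Continuous.mul (by fun_prop) (hc2.comp (by fun_prop))
  have h1 : (fun w : (ℝ × ℝ) × (ℝ × ℝ) => F w.1 - F w.2) = fun w =>
      ∫ t in Icc (0 : ℝ) 1, (fun w : ((ℝ × ℝ) × (ℝ × ℝ)) × ℝ =>
        (w.1.1 - w.1.2).1 * fderiv ℝ F (w.1.2 + w.2 • (w.1.1 - w.1.2)) (1, 0) +
          (w.1.1 - w.1.2).2 * fderiv ℝ F (w.1.2 + w.2 • (w.1.1 - w.1.2)) (0, 1)) (w, t) := by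
    funext w
    exact sub_eq_integral_fderiv_segment hF w.1 w.2
  rw [h1]
  refine (eLpNorm_integral_prod_le hp (c1.add c2).aestronglyMeasurable).trans ?_
  refine (eLpNorm_add_le c1.aestronglyMeasurable c2.aestronglyMeasurable hp).trans ?_
  exact (add_le_add b1 b2).trans_eq (by ring)

/-! ### Mollification -/

open scoped Convolution in
/-- The mollification of `f` with a normed bump function. -/
noncomputable def mollify (φ : ContDiffBump (0 : ℝ × ℝ)) (f : ℝ × ℝ → ℝ) : ℝ × ℝ → ℝ :=
  f ⋆[ContinuousLinearMap.mul ℝ ℝ, volume] φ.normed volume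

theorem mollify_apply (φ : ContDiffBump (0 : ℝ × ℝ)) (f : ℝ × ℝ → ℝ) (x : ℝ × ℝ) :
    mollify φ f x = ∫ t, f t * φ.normed volume (x - t) := rfl

theorem mollify_apply' (φ : ContDiffBump (0 : ℝ × ℝ)) (f : ℝ × ℝ → ℝ) (x : ℝ × ℝ) :
    mollify φ f x = ∫ s, φ.normed volume s * f (x - s) := by
  rw [mollify, convolution_eq_swap]
  simp [mul_comm]

theorem contDiff_mollify (φ : ContDiffBump (0 : ℝ × ℝ)) {f : ℝ × ℝ → ℝ}
    (hf : LocallyIntegrable f volume) : ContDiff ℝ 1 (mollify φ f) :=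
  φ.hasCompactSupport_normed.contDiff_convolution_right _ hf φ.contDiff_normed

/-- Lebesgue differentiation; the bounded ratio of outer to inner radius makes the kernels
comparable with averages over balls. -/
theorem ae_tendsto_mollify {φ : ℕ → ContDiffBump (0 : ℝ × ℝ)} {K : ℝ}
    (hφ : Filter.Tendsto (fun i => (φ i).rOut) Filter.atTop (nhds 0))
    (hK : ∀ i, (φ i).rOut ≤ K * (φ i).rIn) {f : ℝ × ℝ → ℝ} (hf : LocallyIntegrable f volume) :
    ∀ᵐ x, Filter.Tendsto (fun i => mollify (φ i) f x) Filter.atTop (nhds (f x)) := by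
  filter_upwards [ContDiffBump.ae_convolution_tendsto_right_of_locallyIntegrable hφ
    (.of_forall hK) hf] with x hx
  refine hx.congr fun i => ?_
  rw [mollify_apply']
  rfl

/-- Mollification does not increase the `L_p` norm. -/
theorem eLpNorm_mollify_le (φ : ContDiffBump (0 : ℝ × ℝ)) {f : ℝ × ℝ → ℝ}
    (hf : AEStronglyMeasurable f volume) {p : ℝ≥0∞} (hp : 1 ≤ p) :
    eLpNorm (mollify φ f) p volume ≤ eLpNorm f p volume := by
  have hm : Measurable fun s => ENNReal.ofReal (φ.normed volume s) :=
    (φ.continuous_normed).measurable.ennreal_ofReal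
  -- The mollification at x is the mean of f(x - s) over the probability measure κ, and (x, s) ↦ x -
  -- s carries the product of volume and κ to volume. Jensen's inequality then suffices.
  set κ := volume.withDensity fun s => ENNReal.ofReal (φ.normed volume s) with hκ
  have hκ1 : IsProbabilityMeasure κ := by
    refine ⟨?_⟩
    rw [hκ, withDensity_apply _ MeasurableSet.univ, Measure.restrict_univ,
      ← ofReal_integral_eq_lintegral_ofReal φ.integrable_normed (.of_forall φ.nonneg_normed),
      φ.integral_normed, ENNReal.ofReal_one]
  have hsub : Measurable fun w : (ℝ × ℝ) × (ℝ × ℝ) => w.1 - w.2 := by fun_prop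
  have hmap : Measure.map (fun w : (ℝ × ℝ) × (ℝ × ℝ) => w.1 - w.2) (volume.prod κ) = volume := by
    ext A hA
    rw [Measure.map_apply hsub hA, Measure.prod_apply_symm (hsub hA)]
    have (s : ℝ × ℝ) : volume ((fun x => (x, s)) ⁻¹'
        ((fun w : (ℝ × ℝ) × (ℝ × ℝ) => w.1 - w.2) ⁻¹' A)) = volume A := by
      have := measure_preimage_add_right volume (-s) A
      simp only [← sub_eq_add_neg] at this
      exact this
    simp [this]
  have h1 : mollify φ f = fun x => ∫ s, (f ∘ fun w : (ℝ × ℝ) × (ℝ × ℝ) => w.1 - w.2) (x, s) ∂κ := by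
    funext x
    rw [mollify_apply', hκ, integral_withDensity_eq_integral_toReal_smul hm (by simp)]
    refine integral_congr_ae (.of_forall fun s => ?_)
    simp [ENNReal.toReal_ofReal (φ.nonneg_normed s)]
  have hf' : AEStronglyMeasurable f
      (Measure.map (fun w : (ℝ × ℝ) × (ℝ × ℝ) => w.1 - w.2) (volume.prod κ)) := by rwa [hmap]
  rw [h1]
  refine (eLpNorm_integral_prod_le hp (hf'.comp_measurable hsub)).trans_eq ?_
  rw [← eLpNorm_map_measure hf' hsub.aemeasurable, hmap]

/-- Mollification commutes with weak derivatives, away from the boundary. -/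
theorem fderiv_mollify {Ω : Set (ℝ × ℝ)} (hΩ : MeasurableSet Ω) {α : ℕ × ℕ} {e : ℝ × ℝ}
    (he : ∀ ψ : ℝ × ℝ → ℝ, classicalDeriv α ψ = fun z => fderiv ℝ ψ z e)
    (hα : α.1 + α.2 = 1) {f g : L1 Ω} (h : HasWeakDeriv Ω α f g)
    (φ : ContDiffBump (0 : ℝ × ℝ)) {x : ℝ × ℝ} (hx : Metric.closedBall x φ.rOut ⊆ Ω) :
    fderiv ℝ (mollify φ (Ω.indicator f)) x e = mollify φ (Ω.indicator g) x := by
  have hint (k : L1 Ω) : LocallyIntegrable (Ω.indicator k) volume :=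
    ((integrable_indicator_iff hΩ).2 (L1.integrable_coeFn k)).locallyIntegrable
  have hη : ContDiff ℝ ∞ (φ.normed volume) := φ.contDiff_normed
  have hηc : HasCompactSupport (φ.normed volume) := φ.hasCompactSupport_normed
  have hd := (hηc.hasFDerivAt_convolution_right (ContinuousLinearMap.mul ℝ ℝ) (hint f)
    (hη.of_le (by simp)) x).fderiv
  have hex := (hηc.fderiv ℝ).convolutionExists_right
    ((ContinuousLinearMap.mul ℝ ℝ).precompR (ℝ × ℝ)) (hint f)
    (hη.continuous_fderiv (by simp)) x
  have h1 : fderiv ℝ (mollify φ (Ω.indicator f)) x e =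
      ∫ t, Ω.indicator f t * fderiv ℝ (φ.normed volume) (x - t) e := by
    rw [mollify, hd, convolution_def, ContinuousLinearMap.integral_apply hex]
    rfl
  -- The reflected kernel t ↦ φ(x - t) is an admissible test function because the ball around x lies
  -- in Ω. The sign from the reflection cancels the one in the definition of the weak derivative.
  set ψ : ℝ × ℝ → ℝ := fun t => φ.normed volume (x - t) with hψ
  have hψs : ContDiff ℝ ∞ ψ := hη.comp (contDiff_const.sub contDiff_id)
  have hsup : Function.support ψ ⊆ Metric.closedBall x φ.rOut := by
    intro t ht
    have : x - t ∈ Function.support (φ.normed volume) := ht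
    rw [φ.support_normed_eq, mem_ball_zero_iff] at this
    rw [mem_closedBall_iff_norm, norm_sub_rev]
    exact this.le
  have hts : tsupport ψ ⊆ Metric.closedBall x φ.rOut :=
    closure_minimal hsup Metric.isClosed_closedBall
  have hψc : HasCompactSupport ψ :=
    (isCompact_closedBall x φ.rOut).of_isClosed_subset (isClosed_tsupport _) hts
  have hψd (t : ℝ × ℝ) : fderiv ℝ ψ t e = - fderiv ℝ (φ.normed volume) (x - t) e := by
    have h2 : HasFDerivAt (fun t : ℝ × ℝ => x - t) (-ContinuousLinearMap.id ℝ (ℝ × ℝ)) t :=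
      (hasFDerivAt_id t).const_sub x
    have h3 := ((hη.differentiable (by simp)) (x - t)).hasFDerivAt.comp t h2
    rw [show ψ = φ.normed volume ∘ fun t => x - t from rfl, h3.fderiv]
    simp
  have key := h ψ hψs hψc (hts.trans hx)
  rw [hα, pow_one, he] at key
  have hind (k : L1 Ω) (θ : ℝ × ℝ → ℝ) :
      ∫ t, Ω.indicator k t * θ t = ∫ t in Ω, k t * θ t := by
    rw [← integral_indicator hΩ]
    congr 1
    funext t
    by_cases ht : t ∈ Ω <;> simp [ht]
  rw [h1, hind, mollify_apply, hind]
  simp only [hψd, mul_neg, integral_neg] at key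
  linarith

/-! ### From smooth to weakly differentiable functions on convex sets -/

/-- The points of `V` at distance at least `r` from the complement. -/
def innerSet (V : Set (ℝ × ℝ)) (r : ℝ) : Set (ℝ × ℝ) := {x | Metric.ball x r ⊆ V}

/-- A point w in the ball around a x + b y is the same convex combination of the translates of x and
y by w - (a x + b y), which lie in their balls. -/
theorem convex_innerSet {V : Set (ℝ × ℝ)} (hV : Convex ℝ V) (r : ℝ) :
    Convex ℝ (innerSet V r) := by
  intro x hx y hy a b ha hb hab w hw
  rw [mem_ball_iff_norm] at hw
  have h1 : x + (w - (a • x + b • y)) ∈ V := hx (by simpa [mem_ball_iff_norm] using hw)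
  have h2 : y + (w - (a • x + b • y)) ∈ V := hy (by simpa [mem_ball_iff_norm] using hw)
  have h3 := hV h1 h2 ha hb hab
  convert h3 using 1
  have : a • (w - (a • x + b • y)) + b • (w - (a • x + b • y)) = w - (a • x + b • y) := by
    rw [← add_smul, hab, one_smul]
  rw [smul_add, smul_add, add_add_add_comm, this]
  abel

theorem isClosed_innerSet (V : Set (ℝ × ℝ)) (r : ℝ) : IsClosed (innerSet V r) := by
  have : innerSet V r = (⋃ z ∈ Vᶜ, Metric.ball z r)ᶜ := by
    ext x
    simp only [innerSet, mem_ofPred_eq, mem_compl_iff, mem_iUnion, not_exists, subset_def,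
      Metric.mem_ball]
    refine ⟨fun h z hz hx => hz (h z (by rwa [dist_comm])), fun h z hz => ?_⟩
    by_contra hzV
    exact h z hzV (by rwa [dist_comm])
  rw [this]
  exact (isOpen_biUnion fun _ _ => Metric.isOpen_ball).isClosed_compl

/-- The Poincaré inequality on a bounded open convex subset, in terms of mean oscillations. -/
theorem eLpNorm_sub_prod_le {Ω V : Set (ℝ × ℝ)} (hΩ : MeasurableSet Ω) (hVo : IsOpen V)
    (hV : Convex ℝ V) (hVΩ : V ⊆ Ω) {D : ℝ≥0} (hD : ∀ x ∈ V, ∀ y ∈ V, ‖x - y‖ₑ ≤ D)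
    {p : ℝ≥0∞} (hp : 1 ≤ p) {f g₁ g₂ : L1 Ω} (h₁ : HasWeakDeriv Ω (1, 0) f g₁)
    (h₂ : HasWeakDeriv Ω (0, 1) f g₂) :
    eLpNorm (fun w : (ℝ × ℝ) × (ℝ × ℝ) => f w.1 - f w.2) p
        ((volume.restrict V).prod (volume.restrict V)) ≤
      D * (4 * volume V) ^ (1 / p).toReal *
        (eLpNorm g₁ p (volume.restrict Ω) + eLpNorm g₂ p (volume.restrict Ω)) := by
  have hint (k : L1 Ω) : Integrable (Ω.indicator k) volume :=
    (integrable_indicator_iff hΩ).2 (L1.integrable_coeFn k)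
  -- The outer radius is half of 1/(n+1), so that the closed ball of this radius around a point of
  -- `W n` stays in V. The ratio 2 of the radii is fixed, as the almost everywhere convergence
  -- requires.
  let φ : ℕ → ContDiffBump (0 : ℝ × ℝ) := fun n =>
    ⟨1 / (n + 1) / 4, 1 / (n + 1) / 2, by positivity,
      by have : (0 : ℝ) < 1 / (n + 1) := by positivity
         linarith⟩
  let W : ℕ → Set (ℝ × ℝ) := fun n => innerSet V (1 / (n + 1))
  have hlim : Filter.Tendsto (fun n => (φ n).rOut) Filter.atTop (nhds 0) := by
    have := (tendsto_one_div_add_atTop_nhds_zero_nat (𝕜 := ℝ)).div_const 2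
    rwa [zero_div] at this
  have hW (n : ℕ) : W n ⊆ V := fun x hx => hx (Metric.mem_ball_self (by positivity))
  have hWm (n : ℕ) : MeasurableSet (W n) := (isClosed_innerSet _ _).measurableSet
  have hball (n : ℕ) (x : ℝ × ℝ) (hx : x ∈ W n) : Metric.closedBall x (φ n).rOut ⊆ Ω := by
    have h0 : (0 : ℝ) < 1 / (n + 1) := by positivity
    refine (Metric.closedBall_subset_ball ?_).trans (hx.trans hVΩ)
    exact half_lt_self h0
  have hev (x : ℝ × ℝ) (hx : x ∈ V) : ∀ᶠ n in Filter.atTop, x ∈ W n := by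
    obtain ⟨r, hr, hrV⟩ := Metric.isOpen_iff.1 hVo x hx
    filter_upwards [(tendsto_one_div_add_atTop_nhds_zero_nat (𝕜 := ℝ)).eventually_lt_const hr]
      with n hn
    exact (Metric.ball_subset_ball hn.le).trans hrV
  let F : ℕ → ℝ × ℝ → ℝ := fun n => mollify (φ n) (Ω.indicator f)
  have hF (n : ℕ) : ContDiff ℝ 1 (F n) := contDiff_mollify _ (hint f).locallyIntegrable
  have hbound (n : ℕ) : eLpNorm ((W n ×ˢ W n).indicator fun w => F n w.1 - F n w.2) p
      ((volume.restrict V).prod (volume.restrict V)) ≤ D * (4 * volume V) ^ (1 / p).toReal *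
        (eLpNorm g₁ p (volume.restrict Ω) + eLpNorm g₂ p (volume.restrict Ω)) := by
    have hgrad {α : ℕ × ℕ} {e : ℝ × ℝ} {g : L1 Ω}
        (he : ∀ ψ : ℝ × ℝ → ℝ, classicalDeriv α ψ = fun z => fderiv ℝ ψ z e)
        (hα : α.1 + α.2 = 1) (hg : HasWeakDeriv Ω α f g) :
        eLpNorm (fun x => fderiv ℝ (F n) x e) p (volume.restrict (W n)) ≤
          eLpNorm g p (volume.restrict Ω) := by
      calc _ = eLpNorm (mollify (φ n) (Ω.indicator g)) p (volume.restrict (W n)) :=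
            eLpNorm_congr_ae ((ae_restrict_iff' (hWm n)).2 (.of_forall fun x hx =>
              fderiv_mollify hΩ he hα hg (φ n) (hball n x hx)))
        _ ≤ eLpNorm (mollify (φ n) (Ω.indicator g)) p volume := eLpNorm_restrict_le _ _ _ _
        _ ≤ eLpNorm (Ω.indicator g) p volume :=
            eLpNorm_mollify_le _ (hint g).aestronglyMeasurable hp
        _ = _ := eLpNorm_indicator_eq_eLpNorm_restrict hΩ
    rw [eLpNorm_indicator_eq_eLpNorm_restrict ((hWm n).prod (hWm n)), ← Measure.prod_restrict,
      Measure.restrict_restrict (hWm n), inter_eq_left.2 (hW n)]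
    refine (eLpNorm_sub_prod_le_of_contDiff (convex_innerSet hV _) (hWm n)
      (fun x hx y hy => hD x (hW n hx) y (hW n hy)) hp (hF n)).trans ?_
    gcongr
    · exact hW n
    · exact hgrad (fun ψ => rfl) rfl h₁
    · exact hgrad (fun ψ => rfl) rfl h₂
  have hpt : ∀ᵐ x ∂(volume.restrict V),
      Filter.Tendsto (fun n => F n x) Filter.atTop (nhds (f x)) := by
    have hK (n : ℕ) : (φ n).rOut ≤ 2 * (φ n).rIn := by
      change (1 : ℝ) / (n + 1) / 2 ≤ 2 * (1 / (n + 1) / 4)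
      linarith
    refine (ae_restrict_iff' hVo.measurableSet).2 ?_
    filter_upwards [ae_tendsto_mollify hlim hK (hint f).locallyIntegrable] with x hx hxV
    simpa [hVΩ hxV] using hx
  have hconv : ∀ᵐ w ∂((volume.restrict V).prod (volume.restrict V)), Filter.Tendsto
      (fun n => (W n ×ˢ W n).indicator (fun w => F n w.1 - F n w.2) w) Filter.atTop
      (nhds (f w.1 - f w.2)) := by
    have hmem : ∀ᵐ w ∂((volume.restrict V).prod (volume.restrict V)), w ∈ V ×ˢ V := by
      rw [Measure.prod_restrict]
      exact ae_restrict_mem (hVo.measurableSet.prod hVo.measurableSet)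
    filter_upwards [hmem, Measure.quasiMeasurePreserving_fst.ae hpt,
      Measure.quasiMeasurePreserving_snd.ae hpt] with w hw hw1 hw2
    refine (hw1.sub hw2).congr' ?_
    filter_upwards [hev _ hw.1, hev _ hw.2] with n hn1 hn2
    rw [indicator_of_mem (mk_mem_prod hn1 hn2)]
  -- Fatou's lemma; the bound on `W n` × `W n` does not depend on n, since the constant involves
  -- only the diameter bound and the volume of V.
  refine (Lp.eLpNorm_lim_le_liminf_eLpNorm (fun n => ?_) _ hconv).trans
    (Filter.liminf_le_of_le (by isBoundedDefault) fun b hb => ?_)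
  · refine AEStronglyMeasurable.indicator ?_ ((hWm n).prod (hWm n))
    have := (hF n).continuous
    exact Continuous.aestronglyMeasurable (by fun_prop)
  · obtain ⟨n, hn⟩ := hb.exists
    exact hn.trans (hbound n)

/-! ### The Poincaré inequality on a macro-element -/

/-- The oscillation on `V` of functions on `Ω` is controlled by the gradient on `Ω`, in `L_p`. -/
def PoincareOn (Ω : Set (ℝ × ℝ)) (p : ℝ≥0∞) (V : Set (ℝ × ℝ)) : Prop :=
  ∃ C : ℝ≥0, ∀ f g₁ g₂ : L1 Ω, HasWeakDeriv Ω (1, 0) f g₁ → HasWeakDeriv Ω (0, 1) f g₂ →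
    ∃ c : ℝ, eLpNorm (fun x => f x - c) p (volume.restrict V) ≤
      C * (eLpNorm g₁ p (volume.restrict Ω) + eLpNorm g₂ p (volume.restrict Ω))

theorem PoincareOn.mono_ae {Ω V W : Set (ℝ × ℝ)} {p : ℝ≥0∞} (h : PoincareOn Ω p V)
    (hW : W ≤ᵐ[volume] V) : PoincareOn Ω p W := by
  obtain ⟨C, hC⟩ := h
  refine ⟨C, fun f g₁ g₂ h₁ h₂ => ?_⟩
  obtain ⟨c, hc⟩ := hC f g₁ g₂ h₁ h₂
  exact ⟨c, (eLpNorm_mono_measure _ (Measure.restrict_mono_ae hW)).trans hc⟩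

/-- The constant c is the mean over V: then f - c is an average of f(x) - f(y) over y, and its norm
is at most the norm of the oscillation. Normalizing one of the two measures contributes the power of
the inverse volume. -/
theorem poincareOn_of_convex {Ω V : Set (ℝ × ℝ)} (hΩ : MeasurableSet Ω) (hVo : IsOpen V)
    (hV : Convex ℝ V) (hVΩ : V ⊆ Ω) (hne : V.Nonempty) (hb : Bornology.IsBounded V)
    {p : ℝ≥0∞} (hp : 1 ≤ p) : PoincareOn Ω p V := by
  have hm0 : volume V ≠ 0 := (hVo.measure_pos volume hne).ne'
  have hmt : volume V ≠ ⊤ := hb.measure_lt_top.ne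
  obtain ⟨R, hR⟩ := Metric.isBounded_iff.1 hb
  have hD : ∀ x ∈ V, ∀ y ∈ V, ‖x - y‖ₑ ≤ (R.toNNReal : ℝ≥0) := by
    intro x hx y hy
    rw [← ofReal_norm, ← dist_eq_norm]
    exact ENNReal.ofReal_le_ofReal (hR hx hy)
  set A : ℝ≥0∞ := (volume V)⁻¹ ^ (1 / p).toReal *
    (R.toNNReal * (4 * volume V) ^ (1 / p).toReal) with hA
  have hAt : A ≠ ⊤ := by
    refine ENNReal.mul_ne_top (ENNReal.rpow_ne_top_of_nonneg (by simp) (by simp [hm0]))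
      (ENNReal.mul_ne_top (by simp) (ENNReal.rpow_ne_top_of_nonneg (by simp) ?_))
    exact ENNReal.mul_ne_top (by simp) hmt
  set κ := (volume V)⁻¹ • volume.restrict V with hκ
  have hκ1 : IsProbabilityMeasure κ := ⟨by simp [hκ, ENNReal.inv_mul_cancel hm0 hmt]⟩
  refine ⟨A.toNNReal, fun f g₁ g₂ h₁ h₂ => ⟨∫ y, f y ∂κ, ?_⟩⟩
  rw [ENNReal.coe_toNNReal hAt]
  have hfV : Integrable f (volume.restrict V) := (L1.integrable_coeFn f).mono_measure
    (Measure.restrict_mono hVΩ le_rfl)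
  have hfκ : Integrable f κ := hfV.smul_measure (by simp [hm0])
  have h1 : (fun x => f x - ∫ y, f y ∂κ) = fun x =>
      ∫ y, (fun w : (ℝ × ℝ) × (ℝ × ℝ) => f w.1 - f w.2) (x, y) ∂κ := by
    funext x
    change f x - _ = ∫ y, (f x - f y) ∂κ
    rw [integral_sub (integrable_const _) hfκ]
    simp
  have hprod : (volume.restrict V).prod κ =
      (volume V)⁻¹ • ((volume.restrict V).prod (volume.restrict V)) := by
    rw [hκ, Measure.prod_smul_right]
  have hmeas : AEStronglyMeasurable (fun w : (ℝ × ℝ) × (ℝ × ℝ) => f w.1 - f w.2)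
      ((volume.restrict V).prod κ) :=
    hfV.aestronglyMeasurable.comp_fst.sub hfκ.aestronglyMeasurable.comp_snd
  rw [h1]
  refine (eLpNorm_integral_prod_le hp hmeas).trans ?_
  rw [hprod]
  refine (eLpNorm_smul_measure_le _ _ _ _).trans ?_
  rw [smul_eq_mul, hA, mul_assoc]
  gcongr
  exact eLpNorm_sub_prod_le hΩ hVo hV hVΩ hD hp h₁ h₂

/-- The constants for V and W are both close to f on V ∩ W. As this set has positive measure, they
are close to each other, and the one for V also serves on W. -/
theorem PoincareOn.union {Ω V W : Set (ℝ × ℝ)} {p : ℝ≥0∞} (hp : 1 ≤ p)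
    (hV : PoincareOn Ω p V) (hW : PoincareOn Ω p W) (hVm : MeasurableSet V) (hVΩ : V ⊆ Ω)
    (hWΩ : W ⊆ Ω) (hΩ : volume Ω ≠ ⊤) (hVW : volume (V ∩ W) ≠ 0) : PoincareOn Ω p (V ∪ W) := by
  obtain ⟨C₁, hC₁⟩ := hV
  obtain ⟨C₂, hC₂⟩ := hW
  have hp0 : p ≠ 0 := (zero_lt_one.trans_le hp).ne'
  have hWt : volume W ≠ ⊤ := measure_ne_top_of_subset hWΩ hΩ
  have hIt : volume (V ∩ W) ≠ ⊤ := measure_ne_top_of_subset inter_subset_right hWt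
  -- For p = ∞ the exponent is 1 / 0 = 0, so a = b = 1, the right values for constants in L_∞.
  set a : ℝ≥0∞ := volume (V ∩ W) ^ (1 / p.toReal) with ha
  set b : ℝ≥0∞ := volume W ^ (1 / p.toReal) with hb
  have ha0 : a ≠ 0 := by simp [ha, ENNReal.rpow_eq_zero_iff, hVW, hIt]
  have hat : a ≠ ⊤ := ENNReal.rpow_ne_top_of_nonneg (by simp) hIt
  have hbt : b ≠ ⊤ := ENNReal.rpow_ne_top_of_nonneg (by simp) hWt
  set A : ℝ≥0∞ := C₁ + (C₂ + a⁻¹ * (C₁ + C₂) * b) with hA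
  have hAt : A ≠ ⊤ := by
    have : a⁻¹ ≠ ⊤ := by simp [ha0]
    finiteness
  refine ⟨A.toNNReal, fun f g₁ g₂ h₁ h₂ => ?_⟩
  rw [ENNReal.coe_toNNReal hAt]
  obtain ⟨c₁, hc₁⟩ := hC₁ f g₁ g₂ h₁ h₂
  obtain ⟨c₂, hc₂⟩ := hC₂ f g₁ g₂ h₁ h₂
  set G := eLpNorm g₁ p (volume.restrict Ω) + eLpNorm g₂ p (volume.restrict Ω)
  have hmeas (c : ℝ) {U : Set (ℝ × ℝ)} (hU : U ⊆ Ω) :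
      AEStronglyMeasurable (fun x => f x - c) (volume.restrict U) :=
    ((Lp.aestronglyMeasurable f).mono_measure (Measure.restrict_mono hU le_rfl)).sub
      aestronglyMeasurable_const
  have hconst (U : Set (ℝ × ℝ)) (hU : volume U ≠ 0) :
      eLpNorm (fun _ : ℝ × ℝ => c₂ - c₁) p (volume.restrict U) =
        ‖c₂ - c₁‖ₑ * volume U ^ (1 / p.toReal) := by
    rw [eLpNorm_const _ hp0 (by simpa using hU), Measure.restrict_apply_univ]
  have hdiff : ‖c₂ - c₁‖ₑ ≤ a⁻¹ * (C₁ + C₂) * G := by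
    have h3 : ‖c₂ - c₁‖ₑ * a ≤ (C₁ + C₂) * G := by
      rw [ha, ← hconst _ hVW]
      have e : (fun _ : ℝ × ℝ => c₂ - c₁) = (fun x => f x - c₁) - fun x => f x - c₂ := by
        funext x; simp
      rw [e, add_mul]
      refine (eLpNorm_sub_le (hmeas c₁ (inter_subset_left.trans hVΩ))
        (hmeas c₂ (inter_subset_left.trans hVΩ)) hp).trans (add_le_add ?_ ?_)
      · exact (eLpNorm_mono_measure _ (Measure.restrict_mono inter_subset_left le_rfl)).trans hc₁
      · exact (eLpNorm_mono_measure _ (Measure.restrict_mono inter_subset_right le_rfl)).trans hc₂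
    calc ‖c₂ - c₁‖ₑ = a⁻¹ * (‖c₂ - c₁‖ₑ * a) := by
          rw [mul_comm ‖c₂ - c₁‖ₑ, ← mul_assoc, ENNReal.inv_mul_cancel ha0 hat, one_mul]
      _ ≤ a⁻¹ * ((C₁ + C₂) * G) := by gcongr
      _ = _ := by ring
  have hW1 : eLpNorm (fun x => f x - c₁) p (volume.restrict W) ≤
      (C₂ + a⁻¹ * (C₁ + C₂) * b) * G := by
    have e : (fun x => f x - c₁) = (fun x => f x - c₂) + fun _ => c₂ - c₁ := by
      funext x; simp
    rw [e]
    refine (eLpNorm_add_le (hmeas c₂ hWΩ) aestronglyMeasurable_const hp).trans ?_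
    rw [hconst _ fun h => hVW (measure_mono_null inter_subset_right h)]
    calc _ ≤ C₂ * G + a⁻¹ * (C₁ + C₂) * G * b := by gcongr
      _ = _ := by ring
  refine ⟨c₁, ?_⟩
  have hsplit : (fun x => f x - c₁) =
      V.indicator (fun x => f x - c₁) + Vᶜ.indicator (fun x => f x - c₁) :=
    (indicator_self_add_compl _ _).symm
  rw [hsplit]
  refine (eLpNorm_add_le ((hmeas c₁ (union_subset hVΩ hWΩ)).indicator hVm)
    ((hmeas c₁ (union_subset hVΩ hWΩ)).indicator hVm.compl) hp).trans ?_
  rw [eLpNorm_indicator_eq_eLpNorm_restrict hVm,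
    eLpNorm_indicator_eq_eLpNorm_restrict hVm.compl, Measure.restrict_restrict hVm,
    Measure.restrict_restrict hVm.compl, hA, add_mul]
  refine add_le_add ((eLpNorm_mono_measure _ (Measure.restrict_mono ?_ le_rfl)).trans hc₁)
    ((eLpNorm_mono_measure _ (Measure.restrict_mono ?_ le_rfl)).trans hW1)
  · exact inter_subset_left
  · rintro x ⟨hx, hx' | hx'⟩
    exacts [absurd hx' hx, hx']

/-- Any point of a connected open set is reached from a given one through a set on which the
Poincaré inequality holds. -/
theorem exists_poincareOn_of_mem {Ω : Set (ℝ × ℝ)} (hΩ : IsOpen Ω) (hc : IsPreconnected Ω)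
    (hv : volume Ω ≠ ⊤) {p : ℝ≥0∞} (hp : 1 ≤ p) {x y : ℝ × ℝ} (hx : x ∈ Ω) (hy : y ∈ Ω) :
    ∃ V, IsOpen V ∧ V ⊆ Ω ∧ x ∈ V ∧ y ∈ V ∧ PoincareOn Ω p V := by
  have hball (z : ℝ × ℝ) (hz : z ∈ Ω) : ∃ r > 0, Metric.ball z r ⊆ Ω ∧
      PoincareOn Ω p (Metric.ball z r) := by
    obtain ⟨r, hr, hrΩ⟩ := Metric.isOpen_iff.1 hΩ z hz
    exact ⟨r, hr, hrΩ, poincareOn_of_convex hΩ.measurableSet Metric.isOpen_ball (convex_ball z r)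
      hrΩ ⟨z, Metric.mem_ball_self hr⟩ Metric.isBounded_ball hp⟩
  -- The set of reachable points is open and relatively closed in Ω: a ball around a limit point
  -- meets a set already reached in an open set, so the two combine.
  set U : Set (ℝ × ℝ) := {y | ∃ V, IsOpen V ∧ V ⊆ Ω ∧ x ∈ V ∧ y ∈ V ∧ PoincareOn Ω p V} with hU
  have hUo : IsOpen U := by
    refine isOpen_iff_forall_mem_open.2 fun z hz => ?_
    obtain ⟨V, hVo, hVΩ, hxV, hzV, hV⟩ := hz
    exact ⟨V, fun w hw => ⟨V, hVo, hVΩ, hxV, hw, hV⟩, hVo, hzV⟩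
  refine hc.subset_of_closure_inter_subset hUo ?_ ?_ hy
  · obtain ⟨r, hr, hrΩ, h⟩ := hball x hx
    exact ⟨x, hx, _, Metric.isOpen_ball, hrΩ, Metric.mem_ball_self hr, Metric.mem_ball_self hr, h⟩
  · rintro z ⟨hzU, hzΩ⟩
    obtain ⟨r, hr, hrΩ, h⟩ := hball z hzΩ
    obtain ⟨w, hwb, V, hVo, hVΩ, hxV, hwV, hV⟩ :=
      mem_closure_iff.1 hzU _ Metric.isOpen_ball (Metric.mem_ball_self hr)
    refine ⟨V ∪ Metric.ball z r, hVo.union Metric.isOpen_ball, union_subset hVΩ hrΩ, .inl hxV,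
      .inr (Metric.mem_ball_self hr), hV.union hp h hVo.measurableSet hVΩ hrΩ hv ?_⟩
    exact ((hVo.inter Metric.isOpen_ball).measure_pos volume ⟨w, hwV, hwb⟩).ne'

/-- Near the boundary the convex pieces themselves are used, and balls only connect them to a base
point x. All the enlarged sets are open and contain x, so any two of them overlap in positive
measure and finitely many can be combined. -/
theorem poincareOn_of_isConnected {Ω : Set (ℝ × ℝ)} (hΩ : IsOpen Ω) (hc : IsConnected Ω)
    (hv : volume Ω ≠ ⊤) {p : ℝ≥0∞} (hp : 1 ≤ p) {ι : Type*} [Finite ι] (T : ι → Set (ℝ × ℝ))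
    (hTo : ∀ i, IsOpen (T i)) (hTc : ∀ i, Convex ℝ (T i)) (hTn : ∀ i, (T i).Nonempty)
    (hTb : ∀ i, Bornology.IsBounded (T i)) (hTΩ : ∀ i, T i ⊆ Ω)
    (hnull : Ω ≤ᵐ[volume] (⋃ i, T i : Set (ℝ × ℝ))) : PoincareOn Ω p Ω := by
  classical
  obtain ⟨x, hx⟩ := hc.nonempty
  have hreach (i : ι) : ∃ V, IsOpen V ∧ V ⊆ Ω ∧ x ∈ V ∧ T i ⊆ V ∧ PoincareOn Ω p V := by
    obtain ⟨y, hy⟩ := hTn i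
    obtain ⟨V, hVo, hVΩ, hxV, hyV, hV⟩ :=
      exists_poincareOn_of_mem hΩ hc.isPreconnected hv hp hx (hTΩ i hy)
    refine ⟨V ∪ T i, hVo.union (hTo i), union_subset hVΩ (hTΩ i), .inl hxV, subset_union_right,
      hV.union hp (poincareOn_of_convex hΩ.measurableSet (hTo i) (hTc i) (hTΩ i) (hTn i)
        (hTb i) hp) hVo.measurableSet hVΩ (hTΩ i) hv ?_⟩
    exact ((hVo.inter (hTo i)).measure_pos volume ⟨y, hyV, hy⟩).ne'
  have hfin (s : Finset ι) :
      ∃ V, IsOpen V ∧ V ⊆ Ω ∧ x ∈ V ∧ (∀ i ∈ s, T i ⊆ V) ∧ PoincareOn Ω p V := by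
    induction s using Finset.induction_on with
    | empty =>
      obtain ⟨V, hVo, hVΩ, hxV, -, hV⟩ :=
        exists_poincareOn_of_mem hΩ hc.isPreconnected hv hp hx hx
      exact ⟨V, hVo, hVΩ, hxV, by simp, hV⟩
    | insert i s _ ih =>
      obtain ⟨V, hVo, hVΩ, hxV, hTV, hV⟩ := ih
      obtain ⟨W, hWo, hWΩ, hxW, hTW, hW⟩ := hreach i
      refine ⟨V ∪ W, hVo.union hWo, union_subset hVΩ hWΩ, .inl hxV, fun k hk => ?_,
        hV.union hp hW hVo.measurableSet hVΩ hWΩ hv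
          ((hVo.inter hWo).measure_pos volume ⟨x, hxV, hxW⟩).ne'⟩
      rcases Finset.mem_insert.1 hk with rfl | hk
      · exact hTW.trans subset_union_right
      · exact (hTV k hk).trans subset_union_left
  have := Fintype.ofFinite ι
  obtain ⟨V, -, -, -, hTV, hV⟩ := hfin Finset.univ
  exact hV.mono_ae (hnull.trans (LE.le.eventuallyLE
    (iUnion_subset fun i => hTV i (Finset.mem_univ i))))

namespace MacroElement

theorem isOpen_Ω (M : MacroElement) : IsOpen M.Ω := isOpen_interior

theorem volume_Ω_ne_top (M : MacroElement) : volume M.Ω ≠ ⊤ :=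
  measure_ne_top_of_subset interior_subset M.isCompact_dom.measure_lt_top.ne

theorem volume_Ω_ne_zero (M : MacroElement) : volume M.Ω ≠ 0 :=
  (M.isOpen_Ω.measure_pos volume M.isConnected_interior.nonempty).ne'

theorem poincareOn (M : MacroElement) {p : ℝ≥0∞} (hp : 1 ≤ p) : PoincareOn M.Ω p M.Ω := by
  refine poincareOn_of_isConnected M.isOpen_Ω M.isConnected_interior M.volume_Ω_ne_top hp
    (fun i => interior (M.elem i)) (fun i => isOpen_interior)
    (fun i => (M.convex_elem i).interior) M.interior_elem
    (fun i => (M.isCompact_elem i).isBounded.subset interior_subset)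
    (fun i => interior_mono (subset_iUnion _ i)) ?_
  rw [ae_le_set]
  -- The interiors of the elements miss only their frontiers, which are null sets by convexity.
  refine measure_mono_null (t := ⋃ i, frontier (M.elem i)) ?_
    (measure_iUnion_null fun i => (M.convex_elem i).addHaar_frontier volume)
  rintro z ⟨hz, hz'⟩
  obtain ⟨i, hi⟩ := mem_iUnion.1 (interior_subset hz : z ∈ M.dom)
  exact mem_iUnion.2 ⟨i, subset_closure hi, fun h => hz' (mem_iUnion.2 ⟨i, h⟩)⟩

end MacroElement

/-! ### Norm equivalences -/

/-- Hölder's inequality on a set of finite measure; for p = ∞ the exponent in m is 1 - 1 / 0 = 1. -/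
theorem enorm_integral_mul_le {Ω : Set (ℝ × ℝ)} (hv : volume Ω ≠ ⊤) {p : ℝ≥0∞} (hp : 1 ≤ p)
    {φ : ℝ × ℝ → ℝ} {B : ℝ≥0} (hB : ∀ x, ‖φ x‖ₑ ≤ B) :
    ∃ K : ℝ≥0, ∀ h : ℝ × ℝ → ℝ, AEStronglyMeasurable h (volume.restrict Ω) →
      ‖∫ x in Ω, h x * φ x‖ₑ ≤ K * eLpNorm h p (volume.restrict Ω) := by
  set m : ℝ≥0∞ := volume Ω ^ (1 / (1 : ℝ≥0∞).toReal - 1 / p.toReal) with hm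
  have hmt : m ≠ ⊤ := by
    refine ENNReal.rpow_ne_top_of_nonneg ?_ hv
    rcases eq_or_ne p ⊤ with rfl | h
    · simp
    · have : 1 ≤ p.toReal := by
        rw [← ENNReal.toReal_one]
        exact ENNReal.toReal_mono h hp
      have h2 : 1 / p.toReal ≤ 1 := by
        rw [div_le_one (by linarith)]; exact this
      simpa using h2
  refine ⟨B * m.toNNReal, fun h hh => ?_⟩
  have h1 := eLpNorm_le_eLpNorm_mul_rpow_measure_univ hp hh
  rw [eLpNorm_one_eq_lintegral_enorm, Measure.restrict_apply_univ] at h1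
  calc ‖∫ x in Ω, h x * φ x‖ₑ ≤ ∫⁻ x in Ω, ‖h x * φ x‖ₑ := enorm_integral_le_lintegral_enorm _
    _ ≤ ∫⁻ x in Ω, B * ‖h x‖ₑ := by
        refine lintegral_mono fun x => ?_
        rw [enorm_mul, mul_comm]
        gcongr
        exact hB x
    _ = B * ∫⁻ x in Ω, ‖h x‖ₑ := lintegral_const_mul' _ _ (by simp)
    _ ≤ B * (eLpNorm h p (volume.restrict Ω) * m) := by gcongr
    _ = _ := by
        rw [ENNReal.coe_mul, ENNReal.coe_toNNReal hmt]
        ring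

/-- The Poincaré inequality, normalized by an arbitrary functional that does not vanish on the
constants. -/
theorem PoincareOn.eLpNorm_le {Ω : Set (ℝ × ℝ)} (hv : volume Ω ≠ ⊤) {p : ℝ≥0∞} (hp : 1 ≤ p)
    (hΩ : PoincareOn Ω p Ω) {φ : ℝ × ℝ → ℝ} (hφ : Continuous φ) {B : ℝ≥0}
    (hB : ∀ x, ‖φ x‖ₑ ≤ B) (h0 : ∫ x in Ω, φ x ≠ 0) :
    ∃ C : ℝ≥0, ∀ f g₁ g₂ : L1 Ω, HasWeakDeriv Ω (1, 0) f g₁ → HasWeakDeriv Ω (0, 1) f g₂ →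
      eLpNorm f p (volume.restrict Ω) ≤ C * (‖∫ x in Ω, f x * φ x‖ₑ +
        (eLpNorm g₁ p (volume.restrict Ω) + eLpNorm g₂ p (volume.restrict Ω))) := by
  obtain ⟨C, hC⟩ := hΩ
  obtain ⟨K, hK⟩ := enorm_integral_mul_le hv hp hB
  have : IsFiniteMeasure (volume.restrict Ω) := ⟨by simpa using hv.lt_top⟩
  have hp0 : p ≠ 0 := (zero_lt_one.trans_le hp).ne'
  set s : ℝ≥0∞ := ‖∫ x in Ω, φ x‖ₑ with hs
  have hs0 : s ≠ 0 := by simpa [hs] using h0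
  have hst : s ≠ ⊤ := by simp [hs]
  set b : ℝ≥0∞ := volume Ω ^ (1 / p.toReal) with hb
  have hbt : b ≠ ⊤ := ENNReal.rpow_ne_top_of_nonneg (by simp) hv
  set A : ℝ≥0∞ := C + s⁻¹ * (1 + K * C) * b with hA
  have hAt : A ≠ ⊤ := by
    have : s⁻¹ ≠ ⊤ := by simp [hs0]
    finiteness
  refine ⟨A.toNNReal, fun f g₁ g₂ h₁ h₂ => ?_⟩
  rw [ENNReal.coe_toNNReal hAt]
  obtain ⟨c, hc⟩ := hC f g₁ g₂ h₁ h₂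
  set G := eLpNorm g₁ p (volume.restrict Ω) + eLpNorm g₂ p (volume.restrict Ω)
  set J := ‖∫ x in Ω, f x * φ x‖ₑ
  have hφb : ∀ᵐ x ∂volume.restrict Ω, ‖φ x‖ ≤ B :=
    .of_forall fun x => by simpa [← ofReal_norm] using hB x
  have hφi : Integrable φ (volume.restrict Ω) := .of_bound hφ.aestronglyMeasurable B hφb
  have hfi : Integrable (fun x => f x * φ x) (volume.restrict Ω) :=
    (L1.integrable_coeFn f).mul_bdd (c := B) hφ.aestronglyMeasurable hφb
  have hmeas : AEStronglyMeasurable (fun x => f x - c) (volume.restrict Ω) :=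
    (Lp.aestronglyMeasurable f).sub aestronglyMeasurable_const
  -- The functional determines the unknown constant: c ∫ φ = ∫ f φ - ∫ (f - c) φ, where the last
  -- term is controlled by the Poincaré bound on f - c.
  have hcb : ‖c‖ₑ ≤ s⁻¹ * (J + K * (C * G)) := by
    have e : c * ∫ x in Ω, φ x = (∫ x in Ω, f x * φ x) - ∫ x in Ω, (f x - c) * φ x := by
      simp only [sub_mul]
      rw [integral_sub hfi (hφi.const_mul c), integral_const_mul]
      ring
    have h3 : ‖c‖ₑ * s ≤ J + K * (C * G) := by
      rw [hs, ← enorm_mul, e]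
      refine (enorm_sub_le).trans ?_
      gcongr
      exact (hK _ hmeas).trans (by gcongr)
    calc ‖c‖ₑ = s⁻¹ * (‖c‖ₑ * s) := by
          rw [mul_comm ‖c‖ₑ, ← mul_assoc, ENNReal.inv_mul_cancel hs0 hst, one_mul]
      _ ≤ _ := by gcongr
  have e : (f : ℝ × ℝ → ℝ) = (fun x => f x - c) + fun _ => c := by funext x; simp
  have hcn : eLpNorm (fun _ : ℝ × ℝ => c) p (volume.restrict Ω) ≤ ‖c‖ₑ * b := by
    by_cases h : volume Ω = 0
    · simp [Measure.restrict_eq_zero.2 h]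
    · rw [eLpNorm_const _ hp0 (by simpa using h), Measure.restrict_apply_univ]
  rw [e]
  calc _ ≤ eLpNorm (fun x => f x - c) p (volume.restrict Ω) +
        eLpNorm (fun _ : ℝ × ℝ => c) p (volume.restrict Ω) :=
        eLpNorm_add_le hmeas aestronglyMeasurable_const hp
    _ ≤ C * G + s⁻¹ * (J + K * (C * G)) * b := by
        gcongr
        exact hcn.trans (by gcongr)
    _ ≤ C * (J + G) + s⁻¹ * (1 * (J + G) + K * (C * (J + G))) * b := by
        rw [one_mul]
        gcongr <;> simp
    _ = _ := by rw [hA]; ring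

/-! ### Families of derivatives indexed by a hull -/

/-- Downward induction along the hull of a set of multi-indices. -/
theorem hull_induction_bound {Q : Finset (ℕ × ℕ)} {E : Set (ℕ × ℕ)} (hE : E ⊆ hull Q)
    (hE' : ∀ β ∈ E, β ∈ Q → β + (1, 0) ∈ E ∧ β + (0, 1) ∈ E) (𝒩 : Set (ℕ × ℕ → ℝ≥0∞))
    (h : ∀ β ∈ E, β ∈ Q → ∃ C : ℝ≥0, ∀ N ∈ 𝒩,
      N β ≤ C * ((∑ α ∈ hull Q \ Q, N α) + (N (β + (1, 0)) + N (β + (0, 1))))) :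
    ∀ β ∈ E, ∃ C : ℝ≥0, ∀ N ∈ 𝒩, N β ≤ C * ∑ α ∈ hull Q \ Q, N α := by
  have hdeg (β : ℕ × ℕ) (hβ : β ∈ E) : β.1 + β.2 ≤ (hull Q).sup fun α => α.1 + α.2 :=
    Finset.le_sup (f := fun α : ℕ × ℕ => α.1 + α.2) (hE hβ)
  -- Here n bounds the distance of the degree of β to the maximal degree in the hull. An index of
  -- maximal degree in E cannot lie in Q, since its successor would be in E too. The constants
  -- depend on β only and are uniform over `𝒩`.
  suffices H : ∀ n : ℕ, ∀ β ∈ E, (hull Q).sup (fun α => α.1 + α.2) ≤ β.1 + β.2 + n →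
      ∃ C : ℝ≥0, ∀ N ∈ 𝒩, N β ≤ C * ∑ α ∈ hull Q \ Q, N α from
    fun β hβ => H _ β hβ (Nat.le_add_left _ _)
  intro n
  induction n with
  | zero =>
    intro β hβ hle
    by_cases hβQ : β ∈ Q
    · have := hdeg _ (hE' β hβ hβQ).1
      simp only [Prod.fst_add, Prod.snd_add] at this
      omega
    · refine ⟨1, fun N _ => ?_⟩
      rw [ENNReal.coe_one, one_mul]
      exact Finset.single_le_sum (f := N) (fun _ _ => zero_le) (Finset.mem_sdiff.2 ⟨hE hβ, hβQ⟩)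
  | succ n ih =>
    intro β hβ hle
    by_cases hβQ : β ∈ Q
    · obtain ⟨h1, h2⟩ := hE' β hβ hβQ
      obtain ⟨C, hC⟩ := h β hβ hβQ
      obtain ⟨C₁, hC₁⟩ := ih _ h1 (by simp only [Prod.fst_add, Prod.snd_add]; omega)
      obtain ⟨C₂, hC₂⟩ := ih _ h2 (by simp only [Prod.fst_add, Prod.snd_add]; omega)
      refine ⟨C * (1 + (C₁ + C₂)), fun N hN => (hC N hN).trans ?_⟩
      push_cast
      rw [mul_assoc, add_mul, add_mul, one_mul]
      gcongr
      exacts [hC₁ N hN, hC₂ N hN]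
    · refine ⟨1, fun N _ => ?_⟩
      rw [ENNReal.coe_one, one_mul]
      exact Finset.single_le_sum (f := N) (fun _ _ => zero_le) (Finset.mem_sdiff.2 ⟨hE hβ, hβQ⟩)

theorem add_mem_hull {Q : Finset (ℕ × ℕ)} {β : ℕ × ℕ} (h : β ∈ Q) :
    β + (1, 0) ∈ hull Q ∧ β + (0, 1) ∈ hull Q := by
  simp only [hull, Finset.mem_union, Finset.mem_image]
  exact ⟨.inl (.inr ⟨β, h, rfl⟩), .inr ⟨β, h, rfl⟩⟩

theorem subset_hull (Q : Finset (ℕ × ℕ)) : Q ⊆ hull Q := fun _ h => by simp [hull, h]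

/-- `d α`, `α ∈ R`, is a family of derivatives `D^α` of some function. -/
def IsJet (Ω : Set (ℝ × ℝ)) (R : Finset (ℕ × ℕ)) (d : ℕ × ℕ → L1 Ω) : Prop :=
  ∀ α δ, α ∈ R → α + δ ∈ R → HasWeakDeriv Ω δ (d α) (d (α + δ))

theorem isJet_of_hasWeakDeriv {Ω : Set (ℝ × ℝ)} {R : Finset (ℕ × ℕ)} {γ : ℕ × ℕ} {u : L1 Ω}
    {d : ℕ × ℕ → L1 Ω} (h : ∀ α ∈ R, HasWeakDeriv Ω (α + γ) u (d α)) : IsJet Ω R d := by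
  intro α δ hα hδ
  have := h _ hδ
  rw [add_comm α δ, add_assoc] at this
  rw [add_comm α δ]
  exact (h α hα).of_add this

/-- Derivatives with vanishing mean values are bounded by the derivatives on the hull. -/
theorem IsJet.eLpNorm_le_of_integral_eq_zero {Ω : Set (ℝ × ℝ)} (hv : volume Ω ≠ ⊤)
    (hv0 : volume Ω ≠ 0) {p : ℝ≥0∞} (hp : 1 ≤ p) (hΩ : PoincareOn Ω p Ω) (Q : Finset (ℕ × ℕ)) :
    ∀ β ∈ hull Q, ∃ C : ℝ≥0, ∀ d : ℕ × ℕ → L1 Ω, IsJet Ω (hull Q) d →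
      (∀ α ∈ Q, ∫ x in Ω, d α x = 0) → eLpNorm (d β) p (volume.restrict Ω) ≤
        C * ∑ α ∈ hull Q \ Q, eLpNorm (d α) p (volume.restrict Ω) := by
  have hint : ∫ x in Ω, (fun _ : ℝ × ℝ => (1 : ℝ)) x ≠ 0 := by
    simp [Measure.real, ENNReal.toReal_eq_zero_iff, hv, hv0]
  obtain ⟨C, hC⟩ := hΩ.eLpNorm_le hv hp (continuous_const (y := (1 : ℝ))) (B := 1)
    (fun x => by simp) hint
  have key := hull_induction_bound (Q := Q) (E := hull Q) le_rfl
    (fun β _ hβ => add_mem_hull hβ)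
    {N | ∃ d : ℕ × ℕ → L1 Ω, IsJet Ω (hull Q) d ∧ (∀ α ∈ Q, ∫ x in Ω, d α x = 0) ∧
      N = fun α => eLpNorm (d α) p (volume.restrict Ω)} ?_
  · intro β hβ
    obtain ⟨C, hC⟩ := key β hβ
    exact ⟨C, fun d hd hd0 => hC _ ⟨d, hd, hd0, rfl⟩⟩
  · intro β _ hβ
    refine ⟨C, ?_⟩
    rintro _ ⟨d, hd, hd0, rfl⟩
    have hs := add_mem_hull hβ
    have := hC (d β) _ _ (hd β (1, 0) (subset_hull Q hβ) hs.1) (hd β (0, 1) (subset_hull Q hβ) hs.2)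
    simp only [mul_one, hd0 β hβ, enorm_zero, zero_add] at this
    exact this.trans (mul_le_mul' le_rfl le_add_self)

/-- Derivatives above an index of the hull are bounded by the derivatives on the hull. -/
theorem IsJet.eLpNorm_le_of_le {Ω : Set (ℝ × ℝ)} (hΩo : IsOpen Ω) (hne : Ω.Nonempty)
    (hv : volume Ω ≠ ⊤) {p : ℝ≥0∞} (hp : 1 ≤ p) (hΩ : PoincareOn Ω p Ω) (Q : Finset (ℕ × ℕ)) :
    ∀ β ∈ hull Q, (∃ α ∈ hull Q \ Q, α ≤ β) → ∃ C : ℝ≥0, ∀ d : ℕ × ℕ → L1 Ω,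
      IsJet Ω (hull Q) d → eLpNorm (d β) p (volume.restrict Ω) ≤
        C * ∑ α ∈ hull Q \ Q, eLpNorm (d α) p (volume.restrict Ω) := by
  obtain ⟨x₀, hx₀⟩ := hne
  obtain ⟨r, hr, hrΩ⟩ := Metric.isOpen_iff.1 hΩo x₀ hx₀
  -- The means need not vanish here. A weight with compact support in Ω replaces the weight 1, so
  -- that derivatives can be moved onto it.
  let φ : ContDiffBump x₀ := ⟨r / 4, r / 2, by positivity, by linarith⟩
  have hφs : ContDiff ℝ ∞ φ := φ.contDiff
  have hφt : tsupport φ ⊆ Ω := by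
    rw [φ.tsupport_eq]
    exact (Metric.closedBall_subset_ball (by simp only [φ]; linarith)).trans hrΩ
  have hφint : ∫ x in Ω, φ x ≠ 0 := by
    rw [setIntegral_eq_integral_of_forall_compl_eq_zero]
    · exact φ.integral_pos.ne'
    · exact fun x hx => image_eq_zero_of_notMem_tsupport fun h => hx (hφt h)
  have bdd {ψ : ℝ × ℝ → ℝ} (h : Continuous ψ) (hc : HasCompactSupport ψ) :
      ∃ B : ℝ≥0, ∀ x, ‖ψ x‖ₑ ≤ B := by
    obtain ⟨B, hB⟩ := h.bounded_above_of_compact_support hc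
    refine ⟨B.toNNReal, fun x => ?_⟩
    rw [← ofReal_norm]
    exact ENNReal.ofReal_le_ofReal (hB x)
  obtain ⟨B, hB⟩ := bdd φ.continuous φ.hasCompactSupport
  obtain ⟨C, hC⟩ := hΩ.eLpNorm_le hv hp φ.continuous hB hφint
  have key := hull_induction_bound (Q := Q)
    (E := {β | β ∈ hull Q ∧ ∃ α ∈ hull Q \ Q, α ≤ β}) (fun β hβ => hβ.1) ?_
    {N | ∃ d : ℕ × ℕ → L1 Ω, IsJet Ω (hull Q) d ∧
      N = fun α => eLpNorm (d α) p (volume.restrict Ω)} ?_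
  · intro β hβ hα
    obtain ⟨C, hC⟩ := key β ⟨hβ, hα⟩
    exact ⟨C, fun d hd => hC _ ⟨d, hd, rfl⟩⟩
  · rintro β ⟨-, α, hα, hle⟩ hβ
    have hs := add_mem_hull hβ
    exact ⟨⟨hs.1, α, hα, hle.trans (by simp)⟩, ⟨hs.2, α, hα, hle.trans (by simp)⟩⟩
  · rintro β ⟨-, α, hα, hle⟩ hβ
    -- Moving δ onto the bump bounds the weighted mean of d (α + δ) by the norm of d α, one of the
    -- terms of the sum over hull Q \ Q.
    obtain ⟨δ, rfl⟩ := exists_add_of_le hle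
    obtain ⟨hδ, hδc⟩ := classicalDeriv_aux δ hφs φ.hasCompactSupport
    obtain ⟨B', hB'⟩ := bdd hδ.continuous hδc
    obtain ⟨K, hK⟩ := enorm_integral_mul_le hv hp hB'
    refine ⟨C * (K + 1), ?_⟩
    rintro _ ⟨d, hd, rfl⟩
    have hs := add_mem_hull hβ
    have h1 := hC _ _ _ (hd _ (1, 0) (subset_hull Q hβ) hs.1) (hd _ (0, 1) (subset_hull Q hβ) hs.2)
    have hw := hd α δ (Finset.mem_sdiff.1 hα).1 (subset_hull Q hβ) φ hφs φ.hasCompactSupport hφt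
    have h2 : ‖∫ x in Ω, d (α + δ) x * φ x‖ₑ ≤ K * eLpNorm (d α) p (volume.restrict Ω) := by
      refine le_trans (le_of_eq ?_) (hK _ (Lp.aestronglyMeasurable (d α)))
      rw [hw, enorm_mul]
      simp [enorm_pow]
    have h3 : eLpNorm (d α) p (volume.restrict Ω) ≤
        ∑ α ∈ hull Q \ Q, eLpNorm (d α) p (volume.restrict Ω) :=
      Finset.single_le_sum (f := fun α => eLpNorm (d α) p (volume.restrict Ω))
        (fun _ _ => zero_le) hα
    refine h1.trans ?_
    push_cast
    rw [mul_assoc]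
    gcongr
    rw [add_mul, one_mul, mul_add]
    refine add_le_add (h2.trans ?_) le_add_self |>.trans (add_le_add le_self_add le_rfl)
    gcongr

/-! ### Sobolev norms compared with sums of derivative norms -/

theorem derivNorm_le_sobNorm {Ω : Set (ℝ × ℝ)} {P : Finset (ℕ × ℕ)} {p : ℝ≥0∞} (hp : 1 ≤ p)
    {α : ℕ × ℕ} (hα : α ∈ P) (v : L1 Ω) : derivNorm Ω α p v ≤ sobNorm Ω P p v := by
  unfold sobNorm
  split_ifs with h
  · exact Finset.le_sup (f := fun α => derivNorm Ω α p v) hα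
  · have h0 : 0 < p.toReal := ENNReal.toReal_pos (zero_lt_one.trans_le hp).ne' h
    calc derivNorm Ω α p v = (derivNorm Ω α p v ^ p.toReal) ^ (1 / p.toReal) := by
          rw [← ENNReal.rpow_mul, mul_one_div_cancel h0.ne', ENNReal.rpow_one]
      _ ≤ _ := by
          gcongr
          exact Finset.single_le_sum (f := fun α => derivNorm Ω α p v ^ p.toReal)
            (fun _ _ => zero_le) hα

theorem sobNorm_le_sum {Ω : Set (ℝ × ℝ)} (P : Finset (ℕ × ℕ)) {p : ℝ≥0∞} (hp : 1 ≤ p)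
    (v : L1 Ω) : sobNorm Ω P p v ≤ ∑ α ∈ P, derivNorm Ω α p v := by
  classical
  unfold sobNorm
  split_ifs with h
  · exact Finset.sup_le fun α hα =>
      Finset.single_le_sum (f := fun α => derivNorm Ω α p v) (fun _ _ => zero_le) hα
  · have h1 : 1 ≤ p.toReal := by
      rw [← ENNReal.toReal_one]
      exact ENNReal.toReal_mono h hp
    have key : ∑ α ∈ P, derivNorm Ω α p v ^ p.toReal ≤
        (∑ α ∈ P, derivNorm Ω α p v) ^ p.toReal := by
      induction P using Finset.induction_on with
      | empty => simp
      | insert a s ha ih =>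
        rw [Finset.sum_insert ha, Finset.sum_insert ha]
        exact (add_le_add le_rfl ih).trans (ENNReal.add_rpow_le_rpow_add _ _ h1)
    calc _ ≤ ((∑ α ∈ P, derivNorm Ω α p v) ^ p.toReal) ^ (1 / p.toReal) := by gcongr
      _ = _ := by rw [← ENNReal.rpow_mul, mul_one_div_cancel (by linarith), ENNReal.rpow_one]

/-! ### The mean value polynomial -/

/-- The a i are the images of the unit vectors under a linear left inverse of T. This makes
injectivity quantitative: bounds on the coordinates T x i give bounds on x. -/
theorem exists_reconstruction {A ι : Type*} [AddCommGroup A] [Module ℝ A] [Fintype ι]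
    (T : A →ₗ[ℝ] (ι → ℝ)) (hT : Function.Injective T) :
    ∃ a : ι → A, ∀ x, x = ∑ i, T x i • a i := by
  classical
  obtain ⟨g, hg⟩ := T.exists_leftInverse_of_injective (LinearMap.ker_eq_bot.2 hT)
  refine ⟨fun i => g (Pi.single i 1), fun x => ?_⟩
  have h1 : g (T x) = x := LinearMap.congr_fun hg x
  conv_lhs => rw [← h1, pi_eq_sum_univ' (T x), map_sum]
  simp

theorem eLpNorm_coeFn_sum_smul_le {Ω : Set (ℝ × ℝ)} {p : ℝ≥0∞} (hp : 1 ≤ p) {ι : Type*}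
    (s : Finset ι) (c : ι → ℝ) (v : ι → L1 Ω) :
    eLpNorm (∑ i ∈ s, c i • v i : L1 Ω) p (volume.restrict Ω) ≤
      ∑ i ∈ s, ‖c i‖ₑ * eLpNorm (v i) p (volume.restrict Ω) := by
  classical
  induction s using Finset.induction_on with
  | empty =>
    rw [Finset.sum_empty, eLpNorm_congr_ae (Lp.coeFn_zero ℝ 1 (volume.restrict Ω))]
    simp
  | insert i s hi ih =>
    rw [Finset.sum_insert hi, Finset.sum_insert hi, eLpNorm_congr_ae (Lp.coeFn_add _ _)]
    refine (eLpNorm_add_le (Lp.aestronglyMeasurable _) (Lp.aestronglyMeasurable _) hp).trans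
      (add_le_add ?_ ih)
    rw [eLpNorm_congr_ae (Lp.coeFn_smul _ _), eLpNorm_const_smul]

namespace MacroElement

variable (M : MacroElement) (μ : ℕ)

theorem coeFn_toL1 (u : M.CSpace μ) :
    M.toL1 μ u =ᵐ[volume.restrict M.Ω] M.zeroExt u.1 :=
  Integrable.coeFn_toL1 (M.integrable_zeroExt u)

theorem eLpNorm_toL1_lt_top (u : M.CSpace μ) (p : ℝ≥0∞) :
    eLpNorm (M.toL1 μ u) p (volume.restrict M.Ω) < ⊤ := by
  have hfin : IsFiniteMeasure (volume.restrict M.Ω) := ⟨by simpa using M.volume_Ω_ne_top.lt_top⟩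
  obtain ⟨g, hg, hu⟩ := u.2
  obtain ⟨B, hB⟩ := M.isCompact_dom.exists_bound_of_continuousOn hg.continuousOn
  refine (MemLp.of_bound (Lp.aestronglyMeasurable _) B ?_).2
  filter_upwards [M.coeFn_toL1 μ u, ae_restrict_mem M.isOpen_Ω.measurableSet] with z hz hzΩ
  have hzd : z ∈ M.dom := interior_subset hzΩ
  rw [hz]
  simpa [zeroExt, hzd, hu] using hB z hzd

theorem coeFn_toL1_monomial (β : ℕ × ℕ) :
    M.toL1 μ (M.monomial μ β) =ᵐ[volume.restrict M.Ω] fun z => z.1 ^ β.1 * z.2 ^ β.2 := by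
  filter_upwards [M.coeFn_toL1 μ (M.monomial μ β), ae_restrict_mem M.isOpen_Ω.measurableSet]
    with z hz hzΩ
  have hzd : z ∈ M.dom := interior_subset hzΩ
  rw [hz]
  simp [zeroExt, hzd, monomial]

/-- The coefficient of `D^α X^β`. -/
noncomputable def derivCoeff (α β : ℕ × ℕ) : ℝ := (β.1.descFactorial α.1 : ℝ) * (β.2.descFactorial α.2 : ℝ)

/-- This makes the truncated subtraction in the exponents β - α harmless. -/
theorem derivCoeff_eq_zero {α β : ℕ × ℕ} (h : ¬ α ≤ β) : derivCoeff α β = 0 := by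
  rw [Prod.le_def, not_and_or, not_le, not_le] at h
  rcases h with h | h <;> simp [derivCoeff, Nat.descFactorial_of_lt h]

theorem derivCoeff_self_ne_zero (α : ℕ × ℕ) : derivCoeff α α ≠ 0 := by
  simp [derivCoeff, Nat.descFactorial_self, Nat.factorial_ne_zero]

theorem hasWeakDeriv_monomial (α β : ℕ × ℕ) :
    HasWeakDeriv M.Ω α (M.toL1 μ (M.monomial μ β))
      (derivCoeff α β • M.toL1 μ (M.monomial μ (β - α))) := by
  refine hasWeakDeriv_of_contDiff (f := fun z => z.1 ^ β.1 * z.2 ^ β.2) (by fun_prop)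
    (M.coeFn_toL1_monomial μ β) ?_
  rw [classicalDeriv_monomial]
  filter_upwards [Lp.coeFn_smul (derivCoeff α β) (M.toL1 μ (M.monomial μ (β - α))),
    M.coeFn_toL1_monomial μ (β - α)] with z h1 h2
  rw [h1, Pi.smul_apply, h2]
  rfl

/-- The polynomial `∑_{β ∈ Q} c_β X^{β+γ}`. -/
noncomputable def poly (Q : Finset (ℕ × ℕ)) (γ : ℕ × ℕ) (c : ℕ × ℕ → ℝ) : M.CSpace μ :=
  ∑ β ∈ Q, c β • M.monomial μ (β + γ)

/-- The derivative `D^{α+γ}` of `∑_{β ∈ Q} c_β X^{β+γ}`. -/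
noncomputable def polyDeriv (Q : Finset (ℕ × ℕ)) (γ : ℕ × ℕ) (c : ℕ × ℕ → ℝ) (α : ℕ × ℕ) : L1 M.Ω :=
  ∑ β ∈ Q, (c β * derivCoeff (α + γ) (β + γ)) • M.toL1 μ (M.monomial μ (β - α))

theorem hasWeakDeriv_poly (Q : Finset (ℕ × ℕ)) (γ : ℕ × ℕ) (c : ℕ × ℕ → ℝ) (α : ℕ × ℕ) :
    HasWeakDeriv M.Ω (α + γ) (M.toL1 μ (M.poly μ Q γ c)) (M.polyDeriv μ Q γ c α) := by
  rw [poly, map_sum]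
  refine HasWeakDeriv.sum _ fun β _ => ?_
  rw [map_smul, mul_smul]
  have := M.hasWeakDeriv_monomial μ (α + γ) (β + γ)
  rw [add_tsub_add_eq_tsub_right] at this
  exact this.smul _

theorem mem_polySpace_shift {Q : Finset (ℕ × ℕ)} {γ : ℕ × ℕ} {q : M.CSpace μ} :
    q ∈ M.polySpace μ (shift γ Q) ↔ ∃ c : ℕ × ℕ → ℝ, q = M.poly μ Q γ c := by
  have himg : M.monomial μ '' (shift γ Q : Finset (ℕ × ℕ)) =
      (fun β => M.monomial μ (β + γ)) '' (Q : Set (ℕ × ℕ)) := by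
    rw [shift, Finset.coe_image, image_image]
  rw [polySpace, himg, Submodule.mem_span_image_finset_iff_exists_fun]
  classical
  constructor
  · rintro ⟨c, rfl⟩
    refine ⟨fun β => if h : β ∈ Q then c ⟨β, h⟩ else 0, ?_⟩
    rw [poly, ← Finset.sum_coe_sort Q]
    exact Finset.sum_congr rfl fun β _ => by simp
  · rintro ⟨c, rfl⟩
    exact ⟨fun β => c β, Finset.sum_coe_sort Q fun β => c β • M.monomial μ (β + γ)⟩

/-! ### The triangular system for the coefficients -/

/-- The integral of `D^{α+γ} X^{β+γ}` over the reference domain. -/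
noncomputable def meanMatrix (γ α β : ℕ × ℕ) : ℝ :=
  derivCoeff (α + γ) (β + γ) * ∫ z in M.Ω, z.1 ^ (β - α).1 * z.2 ^ (β - α).2

theorem meanMatrix_eq_zero {γ α β : ℕ × ℕ} (h : ¬ α ≤ β) : M.meanMatrix γ α β = 0 := by
  rw [meanMatrix, derivCoeff_eq_zero (by simpa using h), zero_mul]

theorem meanMatrix_self_ne_zero (γ α : ℕ × ℕ) : M.meanMatrix γ α α ≠ 0 := by
  refine mul_ne_zero (derivCoeff_self_ne_zero _) ?_
  simp [Measure.real, ENNReal.toReal_eq_zero_iff, M.volume_Ω_ne_zero, M.volume_Ω_ne_top]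

theorem integral_polyDeriv (Q : Finset (ℕ × ℕ)) (γ : ℕ × ℕ) (c : ℕ × ℕ → ℝ) (α : ℕ × ℕ) :
    ∫ z in M.Ω, M.polyDeriv μ Q γ c α z = ∑ β ∈ Q, M.meanMatrix γ α β * c β := by
  classical
  have hI (v : L1 M.Ω) : ∫ z in M.Ω, v z = L1.integralCLM (E := ℝ) (μ := volume.restrict M.Ω) v :=
    (L1.integral_eq_integral v).symm.trans (L1.integral_eq v)
  rw [hI, polyDeriv, map_sum]
  refine Finset.sum_congr rfl fun β _ => ?_
  rw [map_smul, ← hI, integral_congr_ae (M.coeFn_toL1_monomial μ (β - α)), meanMatrix, smul_eq_mul]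
  ring

/-- The system of linear equations for the coefficients of the mean value polynomial. -/
noncomputable def meanMap (E : Finset (ℕ × ℕ)) (γ : ℕ × ℕ) : (E → ℝ) →ₗ[ℝ] (E → ℝ) :=
  Matrix.toLin' (Matrix.of fun α β : E => M.meanMatrix γ α β)

theorem meanMap_apply (E : Finset (ℕ × ℕ)) (γ : ℕ × ℕ) (c : ℕ × ℕ → ℝ) (α : E) :
    M.meanMap E γ (fun β => c β) α = ∑ β ∈ E, M.meanMatrix γ α β * c β := by
  rw [meanMap, Matrix.toLin'_apply, Matrix.mulVec, dotProduct,
    ← Finset.sum_coe_sort E fun β => M.meanMatrix γ α β * c β]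
  rfl

/-- The matrix is triangular for the partial order, with non-zero diagonal. In the row of an index β
of maximal degree with c β ≠ 0 only the diagonal term survives: any other index above β has larger
degree, hence coefficient 0. -/
theorem meanMap_injective (E : Finset (ℕ × ℕ)) (γ : ℕ × ℕ) :
    Function.Injective (M.meanMap E γ) := by
  rw [← LinearMap.ker_eq_bot, LinearMap.ker_eq_bot']
  intro c hc
  by_contra hne
  obtain ⟨β₀, hβ₀⟩ := Function.ne_iff.1 hne
  obtain ⟨β, hβ, hmax⟩ := Finset.exists_max_image (Finset.univ.filter fun β : E => c β ≠ 0)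
    (fun β => β.1.1 + β.1.2) ⟨β₀, by simpa using hβ₀⟩
  have h0 := congr_fun hc β
  rw [meanMap, Matrix.toLin'_apply, Matrix.mulVec, dotProduct, Finset.sum_eq_single β] at h0
  · exact (mul_ne_zero (M.meanMatrix_self_ne_zero γ β) (Finset.mem_filter.1 hβ).2) h0
  · intro β' _ hne'
    by_cases hle : (β : ℕ × ℕ) ≤ β'
    · have : c β' = 0 := by
        by_contra hc'
        have hd := hmax β' (by simpa using hc')
        have h1 := hle.1
        have h2 := hle.2
        exact hne' (Subtype.ext (Prod.ext (by omega) (by omega)))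
      rw [this, mul_zero]
    · rw [Matrix.of_apply, M.meanMatrix_eq_zero hle, zero_mul]
  · simp

theorem integral_sub_L1 {Ω : Set (ℝ × ℝ)} (v w : L1 Ω) :
    ∫ z in Ω, (v - w : L1 Ω) z = (∫ z in Ω, v z) - ∫ z in Ω, w z := by
  rw [integral_congr_ae (Lp.coeFn_sub v w), ← integral_sub (L1.integrable_coeFn v)
    (L1.integrable_coeFn w)]
  rfl

theorem isMeanPolynomial_poly_iff {Q : Finset (ℕ × ℕ)} {γ : ℕ × ℕ} {u : M.CSpace μ}
    {d : ℕ × ℕ → L1 M.Ω} (hd : ∀ α ∈ Q, HasWeakDeriv M.Ω (α + γ) (M.toL1 μ u) (d α))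
    (c : ℕ × ℕ → ℝ) : M.IsMeanPolynomial Q γ u (M.poly μ Q γ c) ↔
      ∀ α ∈ Q, ∑ β ∈ Q, M.meanMatrix γ α β * c β = ∫ z in M.Ω, d α z := by
  have hw (α : ℕ × ℕ) (hα : α ∈ Q) : HasWeakDeriv M.Ω (α + γ) (M.toL1 μ (u - M.poly μ Q γ c))
      (d α - M.polyDeriv μ Q γ c α) := by
    rw [map_sub]
    exact (hd α hα).sub (M.hasWeakDeriv_poly μ Q γ c α)
  constructor
  · rintro ⟨-, h⟩ α hα
    obtain ⟨g, hg, hg0⟩ := h α hα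
    rw [hg.unique M.isOpen_Ω (hw α hα), integral_sub_L1, integral_polyDeriv] at hg0
    linarith
  · refine fun h => ⟨(M.mem_polySpace_shift μ).2 ⟨c, rfl⟩, fun α hα => ⟨_, hw α hα, ?_⟩⟩
    rw [integral_sub_L1, integral_polyDeriv, h α hα, sub_self]

theorem existsUnique_isMeanPolynomial {Q : Finset (ℕ × ℕ)} {γ : ℕ × ℕ} {u : M.CSpace μ}
    {d : ℕ × ℕ → L1 M.Ω} (hd : ∀ α ∈ Q, HasWeakDeriv M.Ω (α + γ) (M.toL1 μ u) (d α)) :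
    ∃! q, M.IsMeanPolynomial Q γ u q := by
  classical
  have hinj := M.meanMap_injective Q γ
  obtain ⟨c, hc⟩ := (LinearMap.injective_iff_surjective.1 hinj) fun α => ∫ z in M.Ω, d α z
  let c' : ℕ × ℕ → ℝ := fun β => if h : β ∈ Q then c ⟨β, h⟩ else 0
  have hc' : (fun β : Q => c' β) = c := by
    funext β
    simp [c']
  refine ⟨M.poly μ Q γ c', (M.isMeanPolynomial_poly_iff μ hd c').2 fun α hα => ?_, ?_⟩
  · rw [← M.meanMap_apply Q γ c' ⟨α, hα⟩, hc', hc]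
  · intro q hq
    obtain ⟨a, rfl⟩ := (M.mem_polySpace_shift μ).1 hq.1
    have h1 := (M.isMeanPolynomial_poly_iff μ hd a).1 hq
    have h2 : (fun β : Q => a β) = c := by
      refine hinj (funext fun α => ?_)
      rw [meanMap_apply, h1 α α.2, hc]
    refine Finset.sum_congr rfl fun β hβ => ?_
    rw [show a β = c' β from congr_fun (h2.trans hc'.symm) ⟨β, hβ⟩]

/-- The semi-norm of the mean value polynomial is bounded by the semi-norm of the function. -/
theorem eLpNorm_polyDeriv_le {p : ℝ≥0∞} (hp : 1 ≤ p) (Q : Finset (ℕ × ℕ)) (γ : ℕ × ℕ) :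
    ∃ C : ℝ≥0, ∀ (u : M.CSpace μ) (d : ℕ × ℕ → L1 M.Ω) (c : ℕ × ℕ → ℝ),
      (∀ α ∈ hull Q, HasWeakDeriv M.Ω (α + γ) (M.toL1 μ u) (d α)) →
      M.IsMeanPolynomial Q γ u (M.poly μ Q γ c) → ∀ α ∈ hull Q \ Q,
        eLpNorm (M.polyDeriv μ Q γ c α) p (volume.restrict M.Ω) ≤
          C * ∑ α ∈ hull Q \ Q, eLpNorm (d α) p (volume.restrict M.Ω) := by
  classical
  -- These are the only indices whose coefficients can enter D^(α+γ) q for α ∈ hull Q \ Q, and those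
  -- at which the means of u are bounded by its semi-norm.
  set E := Q.filter fun β => ∃ α ∈ hull Q \ Q, α ≤ β with hE
  have hB : ∀ β : E, ∃ C : ℝ≥0, ∀ d : ℕ × ℕ → L1 M.Ω, IsJet M.Ω (hull Q) d →
      ‖∫ z in M.Ω, d β z‖ₑ ≤ C * ∑ α ∈ hull Q \ Q, eLpNorm (d α) p (volume.restrict M.Ω) := by
    rintro ⟨β, hβ⟩
    obtain ⟨hβQ, hβ'⟩ := Finset.mem_filter.1 hβ
    obtain ⟨C, hC⟩ := IsJet.eLpNorm_le_of_le M.isOpen_Ω M.isConnected_interior.nonempty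
      M.volume_Ω_ne_top hp (M.poincareOn hp) Q β (subset_hull Q hβQ) hβ'
    obtain ⟨K, hK⟩ := enorm_integral_mul_le M.volume_Ω_ne_top hp (φ := fun _ => 1) (B := 1)
      (fun _ => by simp)
    refine ⟨K * C, fun d hd => ?_⟩
    have := hK _ (Lp.aestronglyMeasurable (d β))
    simp only [mul_one] at this
    refine this.trans ?_
    rw [ENNReal.coe_mul, mul_assoc]
    gcongr
    exact hC d hd
  choose B hB using hB
  obtain ⟨a, ha⟩ := exists_reconstruction (M.meanMap E γ) (M.meanMap_injective E γ)
  set m : ℕ × ℕ → ℕ × ℕ → ℝ≥0 := fun α β => ‖derivCoeff (α + γ) (β + γ)‖₊ *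
    (eLpNorm (M.toL1 μ (M.monomial μ (β - α))) p (volume.restrict M.Ω)).toNNReal with hm
  refine ⟨∑ α ∈ hull Q \ Q, ∑ β : E, (∑ i : E, B i * ‖a i β‖₊) * m α β,
    fun u d c hd hq α hα => ?_⟩
  set N := ∑ α ∈ hull Q \ Q, eLpNorm (d α) p (volume.restrict M.Ω) with hN
  have hmean := (M.isMeanPolynomial_poly_iff μ
    (fun α hα => hd α (subset_hull Q hα)) c).1 hq
  -- E is closed upwards in Q and the matrix is triangular, so the rows in E form a closed system
  -- for the coefficients in E.
  have hmap (i : E) : M.meanMap E γ (fun β => c β) i = ∫ z in M.Ω, d i z := by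
    obtain ⟨hiQ, α', hα', hle⟩ := Finset.mem_filter.1 i.2
    rw [meanMap_apply, ← hmean i hiQ]
    refine Finset.sum_subset (Finset.filter_subset _ _) fun β hβ hβE => ?_
    rw [M.meanMatrix_eq_zero, zero_mul]
    exact fun h => hβE (Finset.mem_filter.2 ⟨hβ, α', hα', hle.trans h⟩)
  have hc (β : E) : ‖c β‖ₑ ≤ (∑ i : E, B i * ‖a i β‖₊ : ℝ≥0) * N := by
    have h1 := congr_fun (ha fun β => c β) β
    simp only [Finset.sum_apply, Pi.smul_apply, smul_eq_mul, hmap] at h1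
    rw [h1]
    refine (enorm_sum_le _ _).trans ?_
    push_cast
    rw [Finset.sum_mul]
    refine Finset.sum_le_sum fun i _ => ?_
    rw [enorm_mul]
    calc _ ≤ B i * N * ‖a i β‖ₑ := by
          gcongr
          exact hB i d (isJet_of_hasWeakDeriv hd)
      _ = _ := by rw [enorm_eq_nnnorm]; ring
  have hpoly : M.polyDeriv μ Q γ c α = ∑ β ∈ E,
      (c β * derivCoeff (α + γ) (β + γ)) • M.toL1 μ (M.monomial μ (β - α)) := by
    refine (Finset.sum_subset (Finset.filter_subset _ _) fun β hβ hβE => ?_).symm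
    rw [derivCoeff_eq_zero, mul_zero, zero_smul]
    exact fun h => hβE (Finset.mem_filter.2 ⟨hβ, α, hα, by simpa using h⟩)
  calc eLpNorm (M.polyDeriv μ Q γ c α) p (volume.restrict M.Ω)
      ≤ ∑ β ∈ E, ‖c β * derivCoeff (α + γ) (β + γ)‖ₑ *
          eLpNorm (M.toL1 μ (M.monomial μ (β - α))) p (volume.restrict M.Ω) := by
        rw [hpoly]
        exact eLpNorm_coeFn_sum_smul_le hp _ _ _
    _ = ∑ β : E, ‖c β‖ₑ * m α β := by
        rw [← Finset.sum_coe_sort E]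
        refine Finset.sum_congr rfl fun β _ => ?_
        rw [enorm_mul, mul_assoc, hm, ENNReal.coe_mul,
          ENNReal.coe_toNNReal (M.eLpNorm_toL1_lt_top μ _ p).ne, enorm_eq_nnnorm]
        rfl
    _ ≤ ∑ β : E, (∑ i : E, B i * ‖a i β‖₊ : ℝ≥0) * N * m α β := by
        gcongr with β
        exact hc β
    _ = (∑ β : E, (∑ i : E, B i * ‖a i β‖₊) * m α β : ℝ≥0) * N := by
        push_cast
        rw [Finset.sum_mul]
        exact Finset.sum_congr rfl fun β _ => by ring
    _ ≤ _ := by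
        gcongr
        exact Finset.single_le_sum
          (f := fun α => ∑ β : E, (∑ i : E, B i * ‖a i β‖₊) * m α β) (fun _ _ => zero_le) hα

end MacroElement

/-! ### The interpolation error -/

theorem exists_derivs_of_mem_sobolev {Ω : Set (ℝ × ℝ)} {p : ℝ≥0∞} [hp : Fact (1 ≤ p)]
    {γ : ℕ × ℕ} {R : Finset (ℕ × ℕ)} {v : L1 Ω} (hv : v ∈ sobolev Ω (shift γ R) p) :
    ∃ d : ℕ × ℕ → L1 Ω, ∀ α ∈ R, HasWeakDeriv Ω (α + γ) v (d α) ∧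
      eLpNorm (d α) p (volume.restrict Ω) < ⊤ := by
  have h (α : ℕ × ℕ) : ∃ g : L1 Ω, α ∈ R → HasWeakDeriv Ω (α + γ) v g ∧
      eLpNorm g p (volume.restrict Ω) < ⊤ := by
    by_cases hα : α ∈ R
    · obtain ⟨g, hg, hgp⟩ := derivNorm_lt_top.1
        ((sobNorm_lt_top hp.out).1 hv (α + γ) (Finset.mem_image_of_mem _ hα))
      exact ⟨g, fun _ => ⟨hg, hgp.2⟩⟩
    · exact ⟨0, fun h => absurd h hα⟩
  choose d hd using h
  exact ⟨d, hd⟩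

/-- The derivatives of the splines are bounded by the norming functionals. -/
theorem eLpNorm_spline_deriv_le {Ω : Set (ℝ × ℝ)} (hΩ : IsOpen Ω) {p : ℝ≥0∞}
    [hp : Fact (1 ≤ p)] {γ : ℕ × ℕ} {P : Finset (ℕ × ℕ)} {S V : Submodule ℝ (L1 Ω)}
    (hS : S ≤ sobolev Ω (shift γ P) p) (hV : derivSpace γ S ≤ V) {ι : Type*} [Fintype ι]
    (F : ι → V →ₗ[ℝ] ℝ)
    (hF : ∀ s ∈ S, ∀ v : V, HasWeakDeriv Ω γ s v → (∀ i, F i v = 0) → v = 0) :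
    ∃ C : ℝ≥0, ∀ s ∈ S, ∀ v : V, HasWeakDeriv Ω γ s v → ∀ α ∈ P, ∀ k : L1 Ω,
      HasWeakDeriv Ω (α + γ) s k →
        eLpNorm k p (volume.restrict Ω) ≤ C * ∑ i, ‖F i v‖ₑ := by
  let T : derivSpace γ S →ₗ[ℝ] (ι → ℝ) := LinearMap.pi fun i => F i ∘ₗ Submodule.inclusion hV
  have hT : Function.Injective T := by
    rw [← LinearMap.ker_eq_bot, LinearMap.ker_eq_bot']
    rintro ⟨w, s, hs, hw⟩ h0
    have := hF s hs ⟨w, hV ⟨s, hs, hw⟩⟩ hw fun i => congr_fun h0 i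
    have hw0 : w = 0 := congr_arg Subtype.val this
    exact Subtype.ext hw0
  obtain ⟨a, ha⟩ := exists_reconstruction T hT
  -- Finitely many splines t i, whose derivatives of order γ are the a i, carry all the norms that
  -- enter the constant.
  choose t htS ht using fun i => (a i).2
  choose b hb using fun i => exists_derivs_of_mem_sobolev (hS (htS i))
  refine ⟨∑ α ∈ P, ∑ i, (eLpNorm (b i α) p (volume.restrict Ω)).toNNReal,
    fun s hs v hv α hα k hk => ?_⟩
  have hvD : (v : L1 Ω) ∈ derivSpace γ S := ⟨s, hs, hv⟩
  have hsum : (v : L1 Ω) = ∑ i, F i v • (a i : L1 Ω) := by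
    have := congr_arg Subtype.val (ha ⟨v, hvD⟩)
    rw [Submodule.coe_sum] at this
    exact this
  have hk' : k = ∑ i, F i v • b i α := by
    refine (hv.of_add hk).unique hΩ ?_
    rw [hsum]
    exact HasWeakDeriv.sum _ fun i _ => ((ht i).of_add (hb i α hα).1).smul _
  rw [hk']
  refine (eLpNorm_coeFn_sum_smul_le hp.out _ _ _).trans ?_
  rw [Finset.mul_sum]
  refine Finset.sum_le_sum fun i _ => ?_
  rw [mul_comm, ← ENNReal.coe_toNNReal (hb i α hα).2.ne]
  gcongr
  refine le_trans ?_ (Finset.single_le_sum (f := fun α =>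
    ∑ i, (eLpNorm (b i α) p (volume.restrict Ω)).toNNReal) (fun _ _ => zero_le) hα)
  exact Finset.single_le_sum (f := fun i => (eLpNorm (b i α) p (volume.restrict Ω)).toNNReal)
    (fun _ _ => zero_le) (Finset.mem_univ i)

theorem add_mem_hull_shift_sdiff {γ : ℕ × ℕ} {Q : Finset (ℕ × ℕ)} {α : ℕ × ℕ}
    (h : α ∈ hull Q \ Q) : α + γ ∈ hull (shift γ Q) \ shift γ Q := by
  obtain ⟨h1, h2⟩ := Finset.mem_sdiff.1 h
  refine Finset.mem_sdiff.2 ⟨?_, fun h3 => h2 ?_⟩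
  · simp only [hull, shift, Finset.mem_union, Finset.mem_image, exists_exists_and_eq_and] at h1 ⊢
    rcases h1 with (h | ⟨β, hβ, rfl⟩) | ⟨β, hβ, rfl⟩
    · exact .inl (.inl ⟨α, h, rfl⟩)
    · exact .inl (.inr ⟨β, hβ, by abel⟩)
    · exact .inr ⟨β, hβ, by abel⟩
  · obtain ⟨β, hβ, e⟩ := Finset.mem_image.1 h3
    rwa [← add_right_cancel e]

namespace MacroElement

/-- The deviation of a function from its mean value polynomial is bounded by its semi-norm. -/
theorem eLpNorm_sub_polyDeriv_le (M : MacroElement) (μ : ℕ) {p : ℝ≥0∞} (hp : 1 ≤ p)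
    (Q : Finset (ℕ × ℕ)) (γ : ℕ × ℕ) :
    ∃ C : ℝ≥0, ∀ (u : M.CSpace μ) (d : ℕ × ℕ → L1 M.Ω) (c : ℕ × ℕ → ℝ),
      (∀ α ∈ hull Q, HasWeakDeriv M.Ω (α + γ) (M.toL1 μ u) (d α)) →
      M.IsMeanPolynomial Q γ u (M.poly μ Q γ c) → ∀ β ∈ hull Q,
        eLpNorm (d β - M.polyDeriv μ Q γ c β : L1 M.Ω) p (volume.restrict M.Ω) ≤
          C * sobSemi M.Ω (shift γ Q) p (M.toL1 μ u) := by
  obtain ⟨C₁, hC₁⟩ := M.eLpNorm_polyDeriv_le μ hp Q γ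
  have h2 (β : hull Q) := IsJet.eLpNorm_le_of_integral_eq_zero M.volume_Ω_ne_top
    M.volume_Ω_ne_zero hp (M.poincareOn hp) Q β β.2
  choose C₂ hC₂ using h2
  set n : ℝ≥0 := ((hull Q \ Q).card : ℝ≥0)
  -- The outer n counts the terms over hull Q \ Q for u - q. Each is at most (1 + C₁ n) N: 1 from u
  -- itself, C₁ n from q. The sum of the C₂ β dominates every single one.
  refine ⟨(∑ β, C₂ β) * (n * ((1 + C₁ * n))), fun u d c hd hq β hβ => ?_⟩
  set N := sobSemi M.Ω (shift γ Q) p (M.toL1 μ u) with hN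
  have hdN (α : ℕ × ℕ) (hα : α ∈ hull Q \ Q) : eLpNorm (d α) p (volume.restrict M.Ω) ≤ N := by
    rw [← derivNorm_eq M.isOpen_Ω (hd α (Finset.mem_sdiff.1 hα).1)]
    exact derivNorm_le_sobNorm hp (add_mem_hull_shift_sdiff hα) _
  have hsum : ∑ α ∈ hull Q \ Q, eLpNorm (d α) p (volume.restrict M.Ω) ≤ n * N := by
    refine (Finset.sum_le_card_nsmul _ _ _ hdN).trans_eq ?_
    simp [n]
  have hw (α : ℕ × ℕ) (hα : α ∈ hull Q) : HasWeakDeriv M.Ω (α + γ)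
      (M.toL1 μ (u - M.poly μ Q γ c)) (d α - M.polyDeriv μ Q γ c α) := by
    rw [map_sub]
    exact (hd α hα).sub (M.hasWeakDeriv_poly μ Q γ c α)
  have hzero (α : ℕ × ℕ) (hα : α ∈ Q) :
      ∫ z in M.Ω, (d α - M.polyDeriv μ Q γ c α : L1 M.Ω) z = 0 := by
    obtain ⟨g, hg, hg0⟩ := hq.2 α hα
    rwa [← hg.unique M.isOpen_Ω (hw α (subset_hull Q hα))]
  have hH (α : ℕ × ℕ) (hα : α ∈ hull Q \ Q) :
      eLpNorm (d α - M.polyDeriv μ Q γ c α : L1 M.Ω) p (volume.restrict M.Ω) ≤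
        (1 + C₁ * n) * N := by
    rw [eLpNorm_congr_ae (Lp.coeFn_sub _ _)]
    refine (eLpNorm_sub_le (Lp.aestronglyMeasurable _) (Lp.aestronglyMeasurable _) hp).trans ?_
    rw [add_mul, one_mul, mul_assoc]
    exact add_le_add (hdN α hα) ((hC₁ u d c hd hq α hα).trans (by gcongr))
  refine (hC₂ ⟨β, hβ⟩ (fun α => d α - M.polyDeriv μ Q γ c α) (isJet_of_hasWeakDeriv hw)
    hzero).trans ?_
  rw [ENNReal.coe_mul, mul_assoc]
  gcongr
  · exact Finset.single_le_sum (f := C₂) (fun _ _ => zero_le) (Finset.mem_univ _)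
  · refine (Finset.sum_le_card_nsmul _ _ _ hH).trans_eq ?_
    simp [n, mul_assoc]

theorem poly_mem_sobolev (M : MacroElement) (μ : ℕ) (p : ℝ≥0∞) [hp : Fact (1 ≤ p)]
    (R Q : Finset (ℕ × ℕ)) (γ : ℕ × ℕ) (c : ℕ × ℕ → ℝ) :
    M.toL1 μ (M.poly μ Q γ c) ∈ sobolev M.Ω (shift γ R) p := by
  refine (sobNorm_lt_top hp.out).2 fun β hβ => ?_
  obtain ⟨α, -, rfl⟩ := Finset.mem_image.1 hβ
  rw [derivNorm_eq M.isOpen_Ω (M.hasWeakDeriv_poly μ Q γ c α)]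
  refine (eLpNorm_coeFn_sum_smul_le hp.out _ _ _).trans_lt (ENNReal.sum_lt_top.2 fun β _ => ?_)
  exact ENNReal.mul_lt_top enorm_lt_top (M.eLpNorm_toL1_lt_top μ _ p)

/-- Makes u - q admissible for the hypothesis that the functionals are preserved by the
interpolation. -/
theorem IsMeanPolynomial.sub_mem_sobolev {M : MacroElement} {μ : ℕ} {p : ℝ≥0∞} [Fact (1 ≤ p)]
    {R Q : Finset (ℕ × ℕ)} {γ : ℕ × ℕ} {u q : M.CSpace μ} (hq : M.IsMeanPolynomial Q γ u q)
    (hu : M.toL1 μ u ∈ sobolev M.Ω (shift γ R) p) :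
    M.toL1 μ (u - q) ∈ sobolev M.Ω (shift γ R) p := by
  obtain ⟨c, rfl⟩ := (M.mem_polySpace_shift μ).1 hq.1
  rw [map_sub]
  exact Submodule.sub_mem _ hu (M.poly_mem_sobolev μ p R Q γ c)

/-- A Bramble–Hilbert estimate for the mean value polynomial. -/
theorem derivNorm_sub_isMeanPolynomial_le (M : MacroElement) (μ : ℕ) (p : ℝ≥0∞)
    [hp : Fact (1 ≤ p)] (Q : Finset (ℕ × ℕ)) (γ : ℕ × ℕ) :
    ∃ C : ℝ≥0, ∀ u q : M.CSpace μ, M.toL1 μ u ∈ sobolev M.Ω (shift γ (hull Q)) p →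
      M.IsMeanPolynomial Q γ u q → ∀ β ∈ hull Q,
        derivNorm M.Ω (β + γ) p (M.toL1 μ (u - q)) ≤
          C * sobSemi M.Ω (shift γ Q) p (M.toL1 μ u) := by
  obtain ⟨C, hC⟩ := M.eLpNorm_sub_polyDeriv_le μ hp.out Q γ
  refine ⟨C, fun u q hu hq β hβ => ?_⟩
  obtain ⟨c, rfl⟩ := (M.mem_polySpace_shift μ).1 hq.1
  obtain ⟨d, hd⟩ := exists_derivs_of_mem_sobolev hu
  rw [map_sub, derivNorm_eq M.isOpen_Ω ((hd β hβ).1.sub (M.hasWeakDeriv_poly μ Q γ c β))]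
  exact hC u d c (fun α hα => (hd α hα).1) hq β hβ

end MacroElement

theorem derivNorm_add_le {Ω : Set (ℝ × ℝ)} (hΩ : IsOpen Ω) {p : ℝ≥0∞} (hp : 1 ≤ p) (α : ℕ × ℕ)
    (v w : L1 Ω) : derivNorm Ω α p (v + w) ≤ derivNorm Ω α p v + derivNorm Ω α p w := by
  rcases eq_top_or_lt_top (derivNorm Ω α p v) with h | h
  · simp [h]
  rcases eq_top_or_lt_top (derivNorm Ω α p w) with h' | h'
  · simp [h']
  obtain ⟨g, hg, -⟩ := derivNorm_lt_top.1 h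
  obtain ⟨k, hk, -⟩ := derivNorm_lt_top.1 h'
  rw [derivNorm_eq hΩ hg, derivNorm_eq hΩ hk, derivNorm_eq hΩ (hg.add hk),
    eLpNorm_congr_ae (Lp.coeFn_add _ _)]
  exact eLpNorm_add_le (Lp.aestronglyMeasurable _) (Lp.aestronglyMeasurable _) hp

/-- The derivatives of the error of a function and a spline with the same values of the norming
functionals. -/
theorem derivNorm_sub_spline_le {Ω : Set (ℝ × ℝ)} (hΩ : IsOpen Ω) {p : ℝ≥0∞}
    [hp : Fact (1 ≤ p)] {γ : ℕ × ℕ} {P R : Finset (ℕ × ℕ)} (hP0 : (0, 0) ∈ P)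
    (hR0 : (0, 0) ∈ R) (hPR : P ⊆ R) {S : Submodule ℝ (L1 Ω)}
    (hS : S ≤ sobolev Ω (shift γ P) p) {ι : Type*} [Fintype ι]
    (F : ι → (sobolev Ω R p ⊔ derivSpace γ S : Submodule ℝ (L1 Ω)) →ₗ[ℝ] ℝ)
    (hFbounded : ∀ i, ∃ K : ℝ≥0, ∀ v : (sobolev Ω R p ⊔ derivSpace γ S : Submodule ℝ (L1 Ω)),
      (v : L1 Ω) ∈ sobolev Ω R p → ‖F i v‖ₑ ≤ K * sobNorm Ω R p v)
    (hFnorming : ∀ s ∈ S, ∀ v : (sobolev Ω R p ⊔ derivSpace γ S : Submodule ℝ (L1 Ω)),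
      HasWeakDeriv Ω γ s v → (∀ i, F i v = 0) → v = 0) :
    ∃ C : ℝ≥0, ∀ w ∈ sobolev Ω (shift γ R) p, ∀ s ∈ S,
      (∀ v v' : (sobolev Ω R p ⊔ derivSpace γ S : Submodule ℝ (L1 Ω)),
        HasWeakDeriv Ω γ s v → HasWeakDeriv Ω γ w v' → ∀ i, F i v = F i v') →
      ∀ α ∈ P, derivNorm Ω (α + γ) p (w - s) ≤ C * ∑ β ∈ R, derivNorm Ω (β + γ) p w := by
  choose K hK using hFbounded
  obtain ⟨C, hC⟩ := eLpNorm_spline_deriv_le hΩ hS le_sup_right F hFnorming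
  refine ⟨1 + C * ∑ i, K i, fun w hw s hs hsw α hα => ?_⟩
  have hzero : ((0, 0) : ℕ × ℕ) + γ = γ := zero_add γ
  obtain ⟨d, hd⟩ := exists_derivs_of_mem_sobolev hw
  obtain ⟨b, hb⟩ := exists_derivs_of_mem_sobolev (hS hs)
  have hd0 : HasWeakDeriv Ω γ w (d (0, 0)) := hzero ▸ (hd _ hR0).1
  have hb0 : HasWeakDeriv Ω γ s (b (0, 0)) := hzero ▸ (hb _ hP0).1
  -- Derivatives of w of order β + γ are derivatives of D^γ w of order β, so D^γ w lies in the space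
  -- on which the functionals are bounded.
  have hjet (β : ℕ × ℕ) (hβ : β ∈ R) : HasWeakDeriv Ω β (d (0, 0)) (d β) :=
    hd0.of_add (hd β hβ).1
  have hdR : d (0, 0) ∈ sobolev Ω R p :=
    (sobNorm_lt_top hp.out).2 fun β hβ => by
      rw [derivNorm_eq hΩ (hjet β hβ)]
      exact (hd β hβ).2
  have hbD : b (0, 0) ∈ derivSpace γ S := ⟨s, hs, hb0⟩
  set N := ∑ β ∈ R, derivNorm Ω (β + γ) p w with hN
  have hdN : sobNorm Ω R p (d (0, 0)) ≤ N := by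
    refine (sobNorm_le_sum R hp.out _).trans_eq (Finset.sum_congr rfl fun β hβ => ?_)
    rw [derivNorm_eq hΩ (hjet β hβ), derivNorm_eq hΩ (hd β hβ).1]
  have hFN (i : ι) : ‖F i ⟨b (0, 0), Submodule.mem_sup_right hbD⟩‖ₑ ≤ K i * N := by
    rw [hsw ⟨b (0, 0), Submodule.mem_sup_right hbD⟩ ⟨d (0, 0), Submodule.mem_sup_left hdR⟩
      hb0 hd0 i]
    exact (hK i ⟨d (0, 0), Submodule.mem_sup_left hdR⟩ hdR).trans (mul_le_mul' le_rfl hdN)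
  have hbN : eLpNorm (b α) p (volume.restrict Ω) ≤ C * (∑ i, K i : ℝ≥0) * N := by
    refine (hC s hs ⟨b (0, 0), Submodule.mem_sup_right hbD⟩ hb0 α hα _ (hb α hα).1).trans ?_
    refine (mul_le_mul' le_rfl (Finset.sum_le_sum fun i _ => hFN i)).trans_eq ?_
    rw [← Finset.sum_mul, ENNReal.ofNNReal_finsetSum, mul_assoc]
  have hdα : eLpNorm (d α) p (volume.restrict Ω) ≤ N := by
    rw [← derivNorm_eq hΩ (hd α (hPR hα)).1]
    exact Finset.single_le_sum (f := fun β => derivNorm Ω (β + γ) p w) (fun _ _ => zero_le)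
      (hPR hα)
  rw [derivNorm_eq hΩ ((hd α (hPR hα)).1.sub (hb α hα).1), eLpNorm_congr_ae (Lp.coeFn_sub _ _)]
  refine (eLpNorm_sub_le (Lp.aestronglyMeasurable _) (Lp.aestronglyMeasurable _) hp.out).trans
    ((add_le_add hdα hbN).trans_eq ?_)
  push_cast
  ring

/-! ### The interpolation error estimate -/

theorem lemma3 (M : MacroElement) (p : ℝ≥0∞) [Fact (1 ≤ p)] (γ : ℕ × ℕ)
    (P Q : Finset (ℕ × ℕ)) (hP0 : (0, 0) ∈ P) (hQ0 : (0, 0) ∈ Q) (hPQ : P ⊆ hull Q)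
    -- the spline space
    (S : Submodule ℝ (L1 M.Ω)) (hSpoly : M.IsPiecewisePolynomial S)
    (hS : S ≤ sobolev M.Ω (shift γ P) p)
    -- the interpolation operator
    (μ : ℕ) (I : M.CSpace μ →ₗ[ℝ] S)
    -- the associated functionals
    (j : ℕ) (hj : j = Module.finrank ℝ (derivSpace γ S))
    (F : Fin j → (sobolev M.Ω (hull Q) p ⊔ derivSpace γ S : Submodule ℝ (L1 M.Ω)) →ₗ[ℝ] ℝ)
    (hFbounded : ∀ i, ∃ K : ℝ≥0,
      ∀ v : (sobolev M.Ω (hull Q) p ⊔ derivSpace γ S : Submodule ℝ (L1 M.Ω)),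
        (v : L1 M.Ω) ∈ sobolev M.Ω (hull Q) p → ‖F i v‖ₑ ≤ K * sobNorm M.Ω (hull Q) p v)
    (hFpreserved : ∀ u : M.CSpace μ, M.toL1 μ u ∈ sobolev M.Ω (shift γ (hull Q)) p →
      ∀ v w : (sobolev M.Ω (hull Q) p ⊔ derivSpace γ S : Submodule ℝ (L1 M.Ω)),
        HasWeakDeriv M.Ω γ (I u) v → HasWeakDeriv M.Ω γ (M.toL1 μ u) w →
          ∀ i, F i v = F i w)
    (hFnorming : ∀ s ∈ S,
      ∀ v : (sobolev M.Ω (hull Q) p ⊔ derivSpace γ S : Submodule ℝ (L1 M.Ω)),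
        HasWeakDeriv M.Ω γ s v → (∀ i, F i v = 0) → v = 0) :
    (∀ u : M.CSpace μ, M.toL1 μ u ∈ sobolev M.Ω (shift γ (hull Q)) p →
      ∃! q : M.CSpace μ, M.IsMeanPolynomial Q γ u q) ∧
    ∃ C : ℝ≥0, ∀ u : M.CSpace μ, M.toL1 μ u ∈ sobolev M.Ω (shift γ (hull Q)) p →
      ∀ q : M.CSpace μ, M.IsMeanPolynomial Q γ u q →
        sobNorm M.Ω (shift γ P) p (M.toL1 μ u - I u) ≤
          C * (sobSemi M.Ω (shift γ Q) p (M.toL1 μ u) +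
            sobNorm M.Ω (shift γ P) p (M.toL1 μ q - I q)) := by
  have hp : 1 ≤ p := Fact.out
  refine ⟨fun u hu => ?_, ?_⟩
  · obtain ⟨d, hd⟩ := exists_derivs_of_mem_sobolev hu
    exact M.existsUnique_isMeanPolynomial μ fun α hα => (hd α (subset_hull Q hα)).1
  obtain ⟨C₁, hC₁⟩ := M.derivNorm_sub_isMeanPolynomial_le μ p Q γ
  obtain ⟨C₂, hC₂⟩ := derivNorm_sub_spline_le M.isOpen_Ω hP0 (subset_hull Q hQ0) hPQ hS F
    hFbounded hFnorming
  -- The first factor comes from bounding the norm by the sum over P + γ. In the other, C₂ times the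
  -- Bramble–Hilbert sum over the hull accounts for w - Iw, and 1 for q - Iq.
  refine ⟨(shift γ P).card * (C₂ * ((hull Q).card * C₁) + 1), fun u hu q hq => ?_⟩
  have hw := hq.sub_mem_sobolev hu
  set N := sobSemi M.Ω (shift γ Q) p (M.toL1 μ u)
  set R := sobNorm M.Ω (shift γ P) p (M.toL1 μ q - I q)
  have hsplit : M.toL1 μ u - (I u : L1 M.Ω) =
      (M.toL1 μ (u - q) - I (u - q)) + (M.toL1 μ q - I q) := by
    rw [map_sub, map_sub, Submodule.coe_sub]
    abel
  have hsum : ∑ β ∈ hull Q, derivNorm M.Ω (β + γ) p (M.toL1 μ (u - q)) ≤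
      (hull Q).card * C₁ * N := by
    refine (Finset.sum_le_card_nsmul _ _ _ fun β hβ => hC₁ u q hu hq β hβ).trans_eq ?_
    rw [nsmul_eq_mul, mul_assoc]
  rw [hsplit]
  refine (sobNorm_le_sum _ hp _).trans ((Finset.sum_le_card_nsmul _ _
    ((C₂ * ((hull Q).card * C₁) + 1) * (N + R)) fun β hβ => ?_).trans_eq ?_)
  · obtain ⟨α, hα, rfl⟩ := Finset.mem_image.1 hβ
    -- The functionals are compared for u - q, whose derivatives are all controlled by the
    -- semi-norm, instead of for u.
    have h1 := hC₂ _ hw _ (I (u - q)).2 (hFpreserved _ hw) α hα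
    calc _ ≤ C₂ * ((hull Q).card * C₁ * N) + R :=
          (derivNorm_add_le M.isOpen_Ω hp _ _ _).trans
            (add_le_add (h1.trans (mul_le_mul' le_rfl hsum)) (derivNorm_le_sobNorm hp hβ _))
      _ ≤ C₂ * ((hull Q).card * C₁ * (N + R)) + (N + R) := by
          gcongr
          exacts [le_self_add, le_add_self]
      _ = _ := by ring
  · rw [nsmul_eq_mul, ← mul_assoc]
    push_cast
    rfl
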